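/- Let $X$, $\mathcal B$, $\mathcal K$ be (real or complex) Hilbert spaces and let $A_0$ be a densely defined, closed, skew-symmetric linear operator on $X$. A linear relation in a Hilbert space $H$ is a subspace $R\subset H^2$. It is called *dissipative* if $\operatorname{Re}\langle r_1,r_2\rangle\le 0$ for all $(r_1,r_2)\in R$, *maximal dissipative* if it is dissipative and has no proper extension to a dissipative relation in $H$, and *skew-symmetric* if $\operatorname{Re}\langle r_1,r_2\rangle=0$ for all $(r_1,r_2)\in R$. An operator has one of these properties if its graph does. Let $(\mathcal B;B_1,B_2)$ be a *boundary triplet* for $A_0^*$: the maps $B_1,B_2:\operatorname{dom}(A_0^*)\to\mathcal B$ are linear and bounded with respect to the graph norm of $A_0^*$, the map $x\mapsto(B_1x,B_2x)$ is surjective from $\operatorname{dom}(A_0^*)$ onto $\mathcal B^2$, and $$\langle A_0^*x,y\rangle_X+\langle x,A_0^*y\rangle_X=\langle B_1x,B_2y\rangle_{\mathcal B}+\langle B_2x,B_1y\rangle_{\mathcal B}\qquad\text{for all }x,y\in\operatorname{dom}(A_0^*).$$ **Theorem.** Let $W_B=\begin{bmatrix}W_1&W_2\end{bmatrix}:\mathcal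 B^2\to\mathcal K$ be bounded and linear, and let $A$ be the restriction of $A_0^*$ to $$\operatorname{dom}(A)=\{x\in\operatorname{dom}(A_0^*) : W_1B_1x+W_2B_2x=0\}.$$ Then $A$ is densely defined, and the following hold. 1. $A$ is closed. 2. $A$ is dissipative if and only if $\ker W_B$ is a dissipative relation in $\mathcal B$, and $A$ is maximal dissipative if and only if $\ker W_B$ is a maximal dissipative relation in $\mathcal B$. 3. The adjoint of $A$ is $A^*=-A_0^*|_{\operatorname{dom}(A^*)}$, where $$\operatorname{dom}(A^*)=\Big\{x\in\operatorname{dom}(A_0^*) : (B_1x,B_2x)\in\overline{\{(W_2^*k,W_1^*k): k\in\mathcal K\}}\Big\}.$$ 4. $A^*$ is dissipative if and only if $W_1W_2^*+W_2W_1^*\ge 0$ in $\mathcal K$. $A^*$ is skew-symmetric if and only if $W_1W_2^*+W_2W_1^*=0$. 5. $A$ generates a strongly continuous contraction semigroup on $X$ if and only if $A$ is dissipative and $W_1W_2^*+W_2W_1^*\ge 0$. 6. $A$ generates a strongly continuous unitary group on $X$ if and only if $A$ is skew-symmetric and $W_1W_2^*+W_2W_1^*=0$. -/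

import Mathlib

open Filter Topology
open scoped NNReal

noncomputable section

namespace BoundaryTriplets

section Relations

variable {𝕜 : Type*} [RCLike 𝕜]
variable {H : Type*} [NormedAddCommGroup H] [InnerProductSpace 𝕜 H]

/-- A linear relation `R` in `H`, i.e. a subspace of `H × H`, is dissipative if
`Re ⟪r₁, r₂⟫ ≤ 0` for all `(r₁, r₂) ∈ R`. -/
def RelDissipative (R : Submodule 𝕜 (H × H)) : Prop :=
  ∀ r ∈ R, RCLike.re (inner 𝕜 r.1 r.2) ≤ 0

/-- A dissipative relation is maximal dissipative if it has no proper extension to a dissipative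
relation. -/
def RelMaximalDissipative (R : Submodule 𝕜 (H × H)) : Prop :=
  RelDissipative R ∧ ∀ S : Submodule 𝕜 (H × H), RelDissipative S → R ≤ S → S = R

/-- A linear relation `R` is skew-symmetric if `Re ⟪r₁, r₂⟫ = 0` for all `(r₁, r₂) ∈ R`. -/
def RelSkewSymmetric (R : Submodule 𝕜 (H × H)) : Prop :=
  ∀ r ∈ R, RCLike.re (inner 𝕜 r.1 r.2) = 0

/-- An operator is dissipative if its graph is a dissipative relation. -/
def OpDissipative (A : H →ₗ.[𝕜] H) : Prop := RelDissipative A.graph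

/-- An operator is maximal dissipative if its graph is a maximal dissipative relation. -/
def OpMaximalDissipative (A : H →ₗ.[𝕜] H) : Prop := RelMaximalDissipative A.graph

/-- An operator is skew-symmetric if its graph is a skew-symmetric relation. -/
def OpSkewSymmetric (A : H →ₗ.[𝕜] H) : Prop := RelSkewSymmetric A.graph

/-- The graph norm on the domain of an operator. -/
def graphNorm (A : H →ₗ.[𝕜] H) (x : A.domain) : ℝ :=
  Real.sqrt (‖(x : H)‖ ^ 2 + ‖A x‖ ^ 2)

end Relations

section Triplets

variable {𝕜 : Type*} [RCLike 𝕜]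
variable {X : Type*} [NormedAddCommGroup X] [InnerProductSpace 𝕜 X] [CompleteSpace X]
variable {𝓑 : Type*} [NormedAddCommGroup 𝓑] [InnerProductSpace 𝕜 𝓑] [CompleteSpace 𝓑]

/-- A boundary triplet `(𝓑; B₁, B₂)` for the adjoint `A₀*` of an operator `A₀`
(used for `A₀` densely defined, skew-symmetric and closed). The maps `B₁` and `B₂` are bounded
with respect to the graph norm of `A₀*`. -/
structure BoundaryTriplet (A₀ : X →ₗ.[𝕜] X) (𝓑 : Type*) [NormedAddCommGroup 𝓑]
    [InnerProductSpace 𝕜 𝓑] [CompleteSpace 𝓑] where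
  B₁ : A₀.adjoint.domain →ₗ[𝕜] 𝓑
  B₂ : A₀.adjoint.domain →ₗ[𝕜] 𝓑
  bounded₁ : ∃ c : ℝ, ∀ x, ‖B₁ x‖ ≤ c * graphNorm A₀.adjoint x
  bounded₂ : ∃ c : ℝ, ∀ x, ‖B₂ x‖ ≤ c * graphNorm A₀.adjoint x
  surjective : Function.Surjective (B₁.prod B₂)
  green : ∀ x y : A₀.adjoint.domain,
    inner 𝕜 (A₀.adjoint x) (y : X) + inner 𝕜 (x : X) (A₀.adjoint y) =
      inner 𝕜 (B₁ x) (B₂ y) + inner 𝕜 (B₂ x) (B₁ y)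

/-- The restriction of `A₀*` to the subspace `{x ∈ dom A₀* | (B₁ x, B₂ x) ∈ C}`. -/
def BoundaryTriplet.restrict {A₀ : X →ₗ.[𝕜] X} (Γ : BoundaryTriplet A₀ 𝓑)
    (C : Submodule 𝕜 (𝓑 × 𝓑)) : X →ₗ.[𝕜] X :=
  A₀.adjoint.domRestrict ((C.comap (Γ.B₁.prod Γ.B₂)).map A₀.adjoint.domain.subtype)

theorem BoundaryTriplet.mem_domain_restrict {A₀ : X →ₗ.[𝕜] X} (Γ : BoundaryTriplet A₀ 𝓑)
    (C : Submodule 𝕜 (𝓑 × 𝓑)) (x : X) :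
    x ∈ (Γ.restrict C).domain ↔
      ∃ h : x ∈ A₀.adjoint.domain, (Γ.B₁ ⟨x, h⟩, Γ.B₂ ⟨x, h⟩) ∈ C := by
  simp only [BoundaryTriplet.restrict, LinearPMap.domRestrict_domain, Submodule.mem_inf,
    Submodule.mem_map, Submodule.mem_comap]
  constructor
  · rintro ⟨⟨y, hy, rfl⟩, h⟩
    exact ⟨h, hy⟩
  · rintro ⟨h, hC⟩
    exact ⟨⟨⟨x, h⟩, hC, rfl⟩, h⟩

theorem BoundaryTriplet.restrict_le {A₀ : X →ₗ.[𝕜] X} (Γ : BoundaryTriplet A₀ 𝓑)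
    (C : Submodule 𝕜 (𝓑 × 𝓑)) : Γ.restrict C ≤ A₀.adjoint :=
  LinearPMap.domRestrict_le

end Triplets

section Semigroups

variable {𝕜 : Type*} [RCLike 𝕜]
variable {X : Type*} [NormedAddCommGroup X] [InnerProductSpace 𝕜 X] [CompleteSpace X]

/-- A strongly continuous semigroup of contractions. -/
structure IsContractionSemigroup (T : ℝ≥0 → X →L[𝕜] X) : Prop where
  map_zero : T 0 = ContinuousLinearMap.id 𝕜 X
  map_add : ∀ s t, T (s + t) = (T s).comp (T t)
  continuous_orbit : ∀ x, Continuous fun t => T t x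
  contraction : ∀ t, ‖T t‖ ≤ 1

/-- `A` is the infinitesimal generator of a contraction semigroup `T`, i.e.
`A x = lim_{t ↓ 0} (T t x - x) / t`, with domain the set of all `x` for which the limit exists. -/
def GeneratesContractionSemigroup (A : X →ₗ.[𝕜] X) : Prop :=
  ∃ T : ℝ≥0 → X →L[𝕜] X, IsContractionSemigroup T ∧
    ∀ x y : X, (x, y) ∈ A.graph ↔
      Tendsto (fun t : ℝ≥0 => (((t : ℝ) : 𝕜)⁻¹) • (T t x - x)) (𝓝[>] 0) (𝓝 y)

/-- A strongly continuous one-parameter group of unitary operators. -/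
structure IsUnitaryGroup (U : ℝ → X →L[𝕜] X) : Prop where
  map_zero : U 0 = ContinuousLinearMap.id 𝕜 X
  map_add : ∀ s t, U (s + t) = (U s).comp (U t)
  continuous_orbit : ∀ x, Continuous fun t => U t x
  mem_unitary : ∀ t, U t ∈ unitary (X →L[𝕜] X)

/-- `A` is the infinitesimal generator of a unitary group `U`, i.e.
`A x = lim_{t → 0} (U t x - x) / t`, with domain the set of all `x` for which the limit exists. -/
def GeneratesUnitaryGroup (A : X →ₗ.[𝕜] X) : Prop :=
  ∃ U : ℝ → X →L[𝕜] X, IsUnitaryGroup U ∧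
    ∀ x y : X, (x, y) ∈ A.graph ↔
      Tendsto (fun t : ℝ => ((t : 𝕜)⁻¹) • (U t x - x)) (𝓝[≠] 0) (𝓝 y)

end Semigroups

end BoundaryTriplets

end

open BoundaryTriplets

/-!
The boundary map `x ↦ (B₁ x, B₂ x)` translates statements about restrictions of `A₀†` into
statements about linear relations in `𝓑`. On the diagonal, Green's identity reads `Re ⟪x, A₀† x⟫ =
Re ⟪B₁ x, B₂ x⟫`, and the boundary map is onto, so `A₀†|_C` is dissipative exactly when `C` is. Both
boundary values vanish on the domain of `A₀`, hence every `A₀†|_C` extends `-A₀`; this gives density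
of the domain, and shows that the adjoint of `A₀†|_C` is contained in `-A₀†` and all dissipative
extensions of `A₀†|_C` are contained in `A₀†`. The adjoint is therefore `-A₀†|_{C'}`, where `C'` is
the annihilator of `C` for the form in Green's identity (`BoundaryTriplet.adjoint_restrict`), and
for `C = ker [W₁ W₂]` the equality `(ker W)ᗮ = closure (ran W†)` identifies `C'` with the closure of
`{(W₂† k, W₁† k)}` (`mem_topologicalClosure_range_adjoint_iff`). Finally, `2 Re ⟪W₂† k, W₁† k⟫ =
⟪(W₁ W₂† + W₂ W₁†) k, k⟫`, so that the sign of `W₁ W₂† + W₂ W₁†` decides whether `A†` is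
dissipative.

Generation is a general fact about densely defined closed operators: `A` generates a contraction
semigroup if and only if `A` and `A†` are dissipative (`generatesContractionSemigroup_iff`).
Dissipativity of `A` makes the range of `1 - h A` closed and that of `A†` makes it dense, so that
the resolvents are contractions; the exponentials of the bounded Yosida approximations of `A` are
commuting contractions that converge strongly to a semigroup with generator `A`. Conversely, if `T`
is generated by `A`, then `T h x - x = A ∫₀ʰ T s x ds`; pairing with `x` in the domain of `A†`
and letting `h → 0` shows that `A†` is dissipative.

Moreover, `A` generates a unitary group if and only if `A` and `-A` both generate contraction
semigroups, since these are then inverse to each other (`IsContractionSemigroup.comp_eq_id`).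
-/

namespace BoundaryTriplets

/-! ### Dissipative relations -/

section Relations

variable {𝕜 : Type*} [RCLike 𝕜]
variable {H : Type*} [NormedAddCommGroup H] [InnerProductSpace 𝕜 H]

/-- An affine function `c ↦ a + Re (c z)` that is bounded above is constant. -/
theorem eq_zero_of_forall_add_re_mul_nonpos {a : ℝ} {z : 𝕜}
    (h : ∀ c : 𝕜, a + RCLike.re (c * z) ≤ 0) : z = 0 := by
  by_contra hz
  have hz' : 0 < ‖z‖ ^ 2 := by positivity
  -- This `c` gives `a + Re (c * z) = 1`.
  have h1 := h ((((1 - a) / ‖z‖ ^ 2 : ℝ) : 𝕜) * starRingEnd 𝕜 z)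
  rw [mul_assoc, RCLike.conj_mul, ← RCLike.ofReal_pow, ← RCLike.ofReal_mul, RCLike.ofReal_re,
    div_mul_cancel₀ _ hz'.ne'] at h1
  linarith

/-- In a dissipative relation, an element on which the quadratic form vanishes is in the kernel of
the polarized form: the form is semidefinite, so this is its Cauchy-Schwarz inequality. -/
theorem RelDissipative.inner_add_inner_eq_zero {S : Submodule 𝕜 (H × H)} (hS : RelDissipative S)
    {r s : H × H} (hr : r ∈ S) (hs : s ∈ S) (h0 : RCLike.re (inner 𝕜 s.1 s.2) = 0) :
    inner 𝕜 r.1 s.2 + inner 𝕜 r.2 s.1 = 0 := by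
  refine eq_zero_of_forall_add_re_mul_nonpos (a := RCLike.re (inner 𝕜 r.1 r.2)) fun c => ?_
  have h1 := hS _ (S.add_mem hr (S.smul_mem c hs))
  have h2 : RCLike.re (inner 𝕜 s.1 r.2 * starRingEnd 𝕜 c) = RCLike.re (c * inner 𝕜 r.2 s.1) := by
    rw [← inner_conj_symm s.1 r.2, ← map_mul, RCLike.conj_re, mul_comm]
  have h3 : RCLike.re (c * (starRingEnd 𝕜 c * inner 𝕜 s.1 s.2)) = 0 := by
    rw [← mul_assoc, RCLike.mul_conj, ← RCLike.ofReal_pow, RCLike.re_ofReal_mul, h0, mul_zero]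
  simp only [Prod.fst_add, Prod.snd_add, Prod.smul_fst, Prod.smul_snd, inner_add_left,
    inner_add_right, inner_smul_left, inner_smul_right, map_add] at h1
  rw [mul_comm] at h2
  rw [mul_add, map_add, h2, h3] at h1
  rw [mul_add, map_add]
  linarith

theorem RelSkewSymmetric.relDissipative {S : Submodule 𝕜 (H × H)} (hS : RelSkewSymmetric S) :
    RelDissipative S := fun r hr => (hS r hr).le

end Relations

/-! ### Graphs of operators and of their adjoints -/

section Operators

variable {𝕜 : Type*} [RCLike 𝕜]
variable {H : Type*} [NormedAddCommGroup H] [InnerProductSpace 𝕜 H]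

theorem mem_graph_neg {A : H →ₗ.[𝕜] H} {x y : H} : (x, y) ∈ (-A).graph ↔ (x, -y) ∈ A.graph := by
  simp only [LinearPMap.mem_graph_iff]
  constructor
  · rintro ⟨z, h1, h2⟩
    exact ⟨z, h1, by simpa [neg_eq_iff_eq_neg] using h2⟩
  · rintro ⟨z, h1, h2⟩
    exact ⟨z, h1, by simpa [neg_eq_iff_eq_neg] using h2⟩

theorem opDissipative_iff {A : H →ₗ.[𝕜] H} :
    OpDissipative A ↔ ∀ x y, (x, y) ∈ A.graph → RCLike.re (inner 𝕜 x y) ≤ 0 :=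
  ⟨fun h x y hxy => h (x, y) hxy, fun h r hr => h r.1 r.2 hr⟩

theorem opSkewSymmetric_iff {A : H →ₗ.[𝕜] H} :
    OpSkewSymmetric A ↔ ∀ x y, (x, y) ∈ A.graph → RCLike.re (inner 𝕜 x y) = 0 :=
  ⟨fun h x y hxy => h (x, y) hxy, fun h r hr => h r.1 r.2 hr⟩

theorem opSkewSymmetric_iff_opDissipative_neg {A : H →ₗ.[𝕜] H} :
    OpSkewSymmetric A ↔ OpDissipative A ∧ OpDissipative (-A) := by
  simp only [opSkewSymmetric_iff, opDissipative_iff, mem_graph_neg]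
  constructor
  · refine fun h => ⟨fun x y hxy => (h x y hxy).le, fun x y hxy => ?_⟩
    simpa using (h x _ hxy).ge
  · rintro ⟨h1, h2⟩ x y hxy
    have := h2 x (-y) (by simpa using hxy)
    rw [inner_neg_right, map_neg] at this
    exact le_antisymm (h1 x y hxy) (by linarith)

theorem mem_graph_adjoint_iff [CompleteSpace H] {A : H →ₗ.[𝕜] H}
    (hA : Dense (A.domain : Set H)) {x y : H} :
    (x, y) ∈ A.adjoint.graph ↔ ∀ a b, (a, b) ∈ A.graph → inner 𝕜 b x = inner 𝕜 a y := by
  simp only [LinearPMap.adjoint_graph_eq_graph_adjoint hA, Submodule.mem_adjoint_iff, sub_eq_zero]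

theorem adjoint_neg [CompleteSpace H] {A : H →ₗ.[𝕜] H} (hA : Dense (A.domain : Set H)) :
    (-A).adjoint = -A.adjoint := by
  apply LinearPMap.eq_of_eq_graph
  ext ⟨x, y⟩
  rw [mem_graph_neg, mem_graph_adjoint_iff hA, mem_graph_adjoint_iff (by simpa using hA)]
  constructor
  · intro h a b hab
    rw [inner_neg_right, ← h a (-b) (mem_graph_neg.2 (by simpa using hab)), inner_neg_left, neg_neg]
  · intro h a b hab
    have := h a (-b) (mem_graph_neg.1 hab)
    rwa [inner_neg_right, inner_neg_left, neg_inj] at this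

theorem isClosed_neg {A : H →ₗ.[𝕜] H} (hA : A.IsClosed) : (-A).IsClosed := by
  have : ((-A).graph : Set (H × H)) = (fun p : H × H => (p.1, -p.2)) ⁻¹' A.graph := by
    ext ⟨x, y⟩
    exact mem_graph_neg
  rw [LinearPMap.IsClosed, this]
  exact IsClosed.preimage (by fun_prop) hA

end Operators

/-! ### Restrictions of `A₀†` by boundary conditions -/

section Triplets

variable {𝕜 : Type*} [RCLike 𝕜]
variable {X : Type*} [NormedAddCommGroup X] [InnerProductSpace 𝕜 X] [CompleteSpace X]
variable {𝓑 : Type*} [NormedAddCommGroup 𝓑] [InnerProductSpace 𝕜 𝓑] [CompleteSpace 𝓑]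

namespace BoundaryTriplet

variable {A₀ : X →ₗ.[𝕜] X} (Γ : BoundaryTriplet A₀ 𝓑)

theorem mem_graph_restrict {C : Submodule 𝕜 (𝓑 × 𝓑)} {x y : X} :
    (x, y) ∈ (Γ.restrict C).graph ↔ ∃ z : A₀.adjoint.domain,
      (z : X) = x ∧ A₀.adjoint z = y ∧ (Γ.B₁ z, Γ.B₂ z) ∈ C := by
  rw [LinearPMap.mem_graph_iff]
  constructor
  · rintro ⟨⟨w, hw⟩, rfl, rfl⟩
    obtain ⟨h, hC⟩ := (Γ.mem_domain_restrict C w).1 hw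
    exact ⟨⟨w, h⟩, rfl, ((Γ.restrict_le C).2 rfl).symm, hC⟩
  · rintro ⟨z, rfl, rfl, hC⟩
    exact ⟨⟨z, (Γ.mem_domain_restrict C z).2 ⟨z.2, hC⟩⟩, rfl, (Γ.restrict_le C).2 rfl⟩

theorem exists_boundary_eq (u v : 𝓑) : ∃ z, Γ.B₁ z = u ∧ Γ.B₂ z = v := by
  obtain ⟨z, hz⟩ := Γ.surjective (u, v)
  exact ⟨z, congrArg Prod.fst hz, congrArg Prod.snd hz⟩

/-- Green's identity on the diagonal. -/
theorem re_inner_adjoint (z : A₀.adjoint.domain) :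
    RCLike.re (inner 𝕜 (z : X) (A₀.adjoint z)) = RCLike.re (inner 𝕜 (Γ.B₁ z) (Γ.B₂ z)) := by
  have h := congrArg RCLike.re (Γ.green z z)
  rw [map_add, map_add, inner_re_symm (A₀.adjoint z), inner_re_symm (Γ.B₂ z)] at h
  linarith

theorem opDissipative_restrict_iff {C : Submodule 𝕜 (𝓑 × 𝓑)} :
    OpDissipative (Γ.restrict C) ↔ RelDissipative C := by
  rw [opDissipative_iff]
  constructor
  · rintro h ⟨u, v⟩ huv
    obtain ⟨z, rfl, rfl⟩ := Γ.exists_boundary_eq u v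
    exact (Γ.re_inner_adjoint z).symm.trans_le
      (h _ _ (Γ.mem_graph_restrict.2 ⟨z, rfl, rfl, huv⟩))
  · intro h x y hxy
    obtain ⟨z, rfl, rfl, hz⟩ := Γ.mem_graph_restrict.1 hxy
    exact (Γ.re_inner_adjoint z).trans_le (h _ hz)

theorem opDissipative_neg_restrict_iff {C : Submodule 𝕜 (𝓑 × 𝓑)} :
    OpDissipative (-Γ.restrict C) ↔ ∀ r ∈ C, 0 ≤ RCLike.re (inner 𝕜 r.1 r.2) := by
  rw [opDissipative_iff]
  simp only [mem_graph_neg]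
  constructor
  · rintro h ⟨u, v⟩ huv
    obtain ⟨z, rfl, rfl⟩ := Γ.exists_boundary_eq u v
    have := h z (-A₀.adjoint z) (Γ.mem_graph_restrict.2 ⟨z, rfl, by simp, huv⟩)
    rw [inner_neg_right, map_neg, Γ.re_inner_adjoint] at this
    simpa using this
  · intro h x y hxy
    obtain ⟨z, rfl, hy, hz⟩ := Γ.mem_graph_restrict.1 hxy
    rw [← neg_neg y, ← hy, inner_neg_right, map_neg, Γ.re_inner_adjoint]
    simpa using h _ hz

theorem opSkewSymmetric_neg_restrict_iff {C : Submodule 𝕜 (𝓑 × 𝓑)} :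
    OpSkewSymmetric (-Γ.restrict C) ↔ RelSkewSymmetric C := by
  rw [opSkewSymmetric_iff_opDissipative_neg, neg_neg, Γ.opDissipative_restrict_iff,
    Γ.opDissipative_neg_restrict_iff]
  exact ⟨fun h r hr => le_antisymm (h.2 r hr) (h.1 r hr),
    fun h => ⟨fun r hr => (h r hr).ge, fun r hr => (h r hr).le⟩⟩

/-- A densely defined skew-symmetric operator satisfies `A₀ ⊆ -A₀†`. -/
theorem mem_graph_adjoint_of_skew (hA₀_dense : Dense (A₀.domain : Set X))
    (hA₀_skew : OpSkewSymmetric A₀) {x y : X} (hxy : (x, y) ∈ A₀.graph) :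
    (x, -y) ∈ A₀.adjoint.graph := by
  rw [mem_graph_adjoint_iff hA₀_dense]
  intro a b hab
  have := (RelSkewSymmetric.relDissipative hA₀_skew).inner_add_inner_eq_zero hab hxy
    (hA₀_skew _ hxy)
  rw [inner_neg_right, eq_neg_iff_add_eq_zero, add_comm]
  exact this

/-- The operator `-A₀` is contained in every restriction of `A₀†` by a boundary condition: by
Green's identity, both boundary values vanish on the domain of `A₀`. -/
theorem mem_graph_restrict_of_mem_graph (hA₀_dense : Dense (A₀.domain : Set X))
    (hA₀_skew : OpSkewSymmetric A₀) (C : Submodule 𝕜 (𝓑 × 𝓑)) {x y : X}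
    (hxy : (x, y) ∈ A₀.graph) : (x, -y) ∈ (Γ.restrict C).graph := by
  obtain ⟨z, hz1, hz2⟩ := (LinearPMap.mem_graph_iff _).1
    (mem_graph_adjoint_of_skew hA₀_dense hA₀_skew hxy)
  simp only at hz1 hz2
  have key (w : A₀.adjoint.domain) :
      inner 𝕜 (Γ.B₁ z) (Γ.B₂ w) + inner 𝕜 (Γ.B₂ z) (Γ.B₁ w) = 0 := by
    rw [← Γ.green, hz1, hz2, inner_neg_left,
      (mem_graph_adjoint_iff hA₀_dense).1 (A₀.adjoint.mem_graph w) x y hxy, neg_add_cancel]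
  -- Test with elements of prescribed boundary values.
  have h1 : Γ.B₁ z = 0 := by
    obtain ⟨w, hw1, hw2⟩ := Γ.exists_boundary_eq 0 (Γ.B₁ z)
    simpa [hw1, hw2] using key w
  have h2 : Γ.B₂ z = 0 := by
    obtain ⟨w, hw1, hw2⟩ := Γ.exists_boundary_eq (Γ.B₂ z) 0
    simpa [hw1, hw2] using key w
  exact Γ.mem_graph_restrict.2 ⟨z, hz1, hz2, by rw [h1, h2]; exact C.zero_mem⟩

theorem dense_domain_restrict (hA₀_dense : Dense (A₀.domain : Set X))
    (hA₀_skew : OpSkewSymmetric A₀) (C : Submodule 𝕜 (𝓑 × 𝓑)) :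
    Dense ((Γ.restrict C).domain : Set X) := by
  refine hA₀_dense.mono fun x hx => ?_
  exact LinearPMap.mem_domain_iff.2
    ⟨_, Γ.mem_graph_restrict_of_mem_graph hA₀_dense hA₀_skew C (A₀.mem_graph ⟨x, hx⟩)⟩

/-- The boundary map as a bounded operator on the graph of `A₀†`. -/
theorem exists_boundaryCLM : ∃ β : A₀.adjoint.graph →L[𝕜] 𝓑 × 𝓑,
    ∀ z : A₀.adjoint.domain, β ⟨(z, A₀.adjoint z), A₀.adjoint.mem_graph z⟩ = (Γ.B₁ z, Γ.B₂ z) := by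
  let e : A₀.adjoint.graph →ₗ[𝕜] A₀.adjoint.domain :=
    ((LinearMap.fst 𝕜 X X).comp A₀.adjoint.graph.subtype).codRestrict _ fun p =>
      LinearPMap.mem_domain_iff.2 ⟨p.1.2, p.2⟩
  have he (p : A₀.adjoint.graph) : A₀.adjoint (e p) = p.1.2 :=
    ((LinearPMap.image_iff (e p).2).2 p.2).symm
  have hnorm (p : A₀.adjoint.graph) : graphNorm A₀.adjoint (e p) ≤ 2 * ‖p‖ := by
    rw [graphNorm, he]
    have h1 : ‖((e p : A₀.adjoint.domain) : X)‖ ≤ ‖p‖ := norm_fst_le p.1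
    have h2 : ‖p.1.2‖ ≤ ‖p‖ := norm_snd_le p.1
    refine Real.sqrt_le_iff.2 ⟨by positivity, ?_⟩
    nlinarith [norm_nonneg ((e p : A₀.adjoint.domain) : X), norm_nonneg p.1.2, norm_nonneg p]
  obtain ⟨c₁, hc₁⟩ := Γ.bounded₁
  obtain ⟨c₂, hc₂⟩ := Γ.bounded₂
  have bd (B : A₀.adjoint.domain →ₗ[𝕜] 𝓑) (c : ℝ) (h : ∀ x, ‖B x‖ ≤ c * graphNorm A₀.adjoint x)
      (p : A₀.adjoint.graph) : ‖B.comp e p‖ ≤ (|c| * 2) * ‖p‖ := by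
    refine (h _).trans ?_
    rw [mul_assoc]
    refine (mul_le_mul_of_nonneg_right (le_abs_self c) (Real.sqrt_nonneg _)).trans ?_
    exact mul_le_mul_of_nonneg_left (hnorm p) (abs_nonneg c)
  exact ⟨((Γ.B₁.comp e).mkContinuous _ (bd _ _ hc₁)).prod
    ((Γ.B₂.comp e).mkContinuous _ (bd _ _ hc₂)), fun z => rfl⟩

theorem isClosed_restrict (hA₀_dense : Dense (A₀.domain : Set X)) {C : Submodule 𝕜 (𝓑 × 𝓑)}
    (hC : IsClosed (C : Set (𝓑 × 𝓑))) : (Γ.restrict C).IsClosed := by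
  obtain ⟨β, hβ⟩ := Γ.exists_boundaryCLM
  have h : ((Γ.restrict C).graph : Set (X × X)) =
      Subtype.val '' (β ⁻¹' (C : Set (𝓑 × 𝓑))) := by
    ext ⟨x, y⟩
    constructor
    · intro hxy
      obtain ⟨z, rfl, rfl, hz⟩ := Γ.mem_graph_restrict.1 hxy
      exact ⟨_, by rw [Set.mem_preimage, hβ z]; exact hz, rfl⟩
    · rintro ⟨⟨⟨x', y'⟩, hp⟩, hp', h⟩
      obtain ⟨rfl, rfl⟩ := Prod.mk_inj.1 h
      obtain ⟨z, hz1, hz2⟩ := (LinearPMap.mem_graph_iff _).1 hp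
      simp only at hz1 hz2
      subst hz1 hz2
      exact Γ.mem_graph_restrict.2 ⟨z, rfl, rfl, by rw [← hβ z]; exact hp'⟩
  rw [LinearPMap.IsClosed, h]
  exact (LinearPMap.adjoint_isClosed hA₀_dense).isClosedEmbedding_subtypeVal.isClosedMap _
    (hC.preimage β.continuous)

/-- A dissipative relation that contains the graph of `-A₀` is contained in the graph of `A₀†`.
A dissipative extension of `A₀†|_C` is thus determined by its boundary values, which form a
dissipative extension of `C`. -/
theorem opMaximalDissipative_restrict_iff (hA₀_dense : Dense (A₀.domain : Set X))
    (hA₀_skew : OpSkewSymmetric A₀) {C : Submodule 𝕜 (𝓑 × 𝓑)} :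
    OpMaximalDissipative (Γ.restrict C) ↔ RelMaximalDissipative C := by
  refine and_congr Γ.opDissipative_restrict_iff ⟨fun h S hS hCS => ?_, fun h S hS hCS => ?_⟩
  · have hle : (Γ.restrict C).graph ≤ (Γ.restrict S).graph := by
      rintro ⟨x, y⟩ hxy
      obtain ⟨z, h1, h2, hz⟩ := Γ.mem_graph_restrict.1 hxy
      exact Γ.mem_graph_restrict.2 ⟨z, h1, h2, hCS hz⟩
    have heq := h _ (Γ.opDissipative_restrict_iff.2 hS) hle
    refine le_antisymm ?_ hCS
    rintro ⟨u, v⟩ huv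
    obtain ⟨z, rfl, rfl⟩ := Γ.exists_boundary_eq u v
    have hz : ((z : X), A₀.adjoint z) ∈ (Γ.restrict S).graph :=
      Γ.mem_graph_restrict.2 ⟨z, rfl, rfl, huv⟩
    rw [heq] at hz
    obtain ⟨z', h1, -, hz'⟩ := Γ.mem_graph_restrict.1 hz
    rwa [Subtype.ext h1] at hz'
  · have hS_adj : S ≤ A₀.adjoint.graph := by
      rintro ⟨x, y⟩ hxy
      rw [mem_graph_adjoint_iff hA₀_dense]
      intro a b hab
      have h1 := hCS (Γ.mem_graph_restrict_of_mem_graph hA₀_dense hA₀_skew C hab)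
      have h2 := hS.inner_add_inner_eq_zero hxy h1 (by simpa using hA₀_skew _ hab)
      have h3 := congrArg (starRingEnd 𝕜) h2
      simp only [inner_neg_right, map_add, map_neg, inner_conj_symm, map_zero] at h3
      exact (neg_add_eq_zero.1 h3)
    -- `S'` is the relation of boundary values of the extension `S`.
    let S' : Submodule 𝕜 (𝓑 × 𝓑) :=
      (S.comap (A₀.adjoint.domain.subtype.prod A₀.adjoint.toFun)).map (Γ.B₁.prod Γ.B₂)
    have hS' : S' = C := by
      refine h S' ?_ ?_
      · rintro _ ⟨z, hz, rfl⟩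
        exact (Γ.re_inner_adjoint z).symm.trans_le (hS _ hz)
      · rintro ⟨u, v⟩ huv
        obtain ⟨z, rfl, rfl⟩ := Γ.exists_boundary_eq u v
        exact ⟨z, hCS (Γ.mem_graph_restrict.2 ⟨z, rfl, rfl, huv⟩), rfl⟩
    refine le_antisymm ?_ hCS
    rintro ⟨x, y⟩ hxy
    obtain ⟨z, h1, h2⟩ := (LinearPMap.mem_graph_iff _).1 (hS_adj hxy)
    simp only at h1 h2
    subst h1 h2
    exact Γ.mem_graph_restrict.2 ⟨z, rfl, rfl, hS'.le ⟨z, hxy, rfl⟩⟩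

/-- The adjoint boundary condition: `(A₀†|_C)† = -A₀†|_{C'}`, where `C'` is the annihilator of `C`
with respect to the form on the right-hand side of Green's identity. -/
theorem adjoint_restrict (hA₀_dense : Dense (A₀.domain : Set X))
    (hA₀_skew : OpSkewSymmetric A₀) (C C' : Submodule 𝕜 (𝓑 × 𝓑))
    (hC' : ∀ r, r ∈ C' ↔ ∀ s ∈ C, inner 𝕜 s.1 r.2 + inner 𝕜 s.2 r.1 = 0) :
    (Γ.restrict C).adjoint = -Γ.restrict C' := by
  have hdense := Γ.dense_domain_restrict hA₀_dense hA₀_skew C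
  apply LinearPMap.eq_of_eq_graph
  ext ⟨x, y⟩
  rw [mem_graph_neg, mem_graph_adjoint_iff hdense, Γ.mem_graph_restrict]
  constructor
  · intro h
    have hadj : (x, -y) ∈ A₀.adjoint.graph := by
      rw [mem_graph_adjoint_iff hA₀_dense]
      intro a b hab
      have := h a (-b) (Γ.mem_graph_restrict_of_mem_graph hA₀_dense hA₀_skew C hab)
      rwa [inner_neg_left, neg_eq_iff_eq_neg, ← inner_neg_right] at this
    obtain ⟨z, h1, h2⟩ := (LinearPMap.mem_graph_iff _).1 hadj
    simp only at h1 h2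
    refine ⟨z, h1, h2, (hC' _).2 ?_⟩
    rintro ⟨u, v⟩ huv
    obtain ⟨w, rfl, rfl⟩ := Γ.exists_boundary_eq u v
    rw [← Γ.green, h1, h2, h w _ (Γ.mem_graph_restrict.2 ⟨w, rfl, rfl, huv⟩), inner_neg_right,
      add_neg_cancel]
  · rintro ⟨z, rfl, h2, hz⟩ a b hab
    obtain ⟨w, rfl, rfl, hw⟩ := Γ.mem_graph_restrict.1 hab
    have := (hC' _).1 hz _ hw
    rwa [← Γ.green, h2, inner_neg_right, ← sub_eq_add_neg, sub_eq_zero] at this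

end BoundaryTriplet

/-! ### Boundary conditions given by operators `W₁`, `W₂` -/

section BoundaryOperators

variable {𝓚 : Type*} [NormedAddCommGroup 𝓚] [InnerProductSpace 𝕜 𝓚] [CompleteSpace 𝓚]

/-- The annihilator of `ker [W₁ W₂]` for the form of Green's identity. -/
theorem mem_topologicalClosure_range_adjoint_iff (W₁ W₂ : 𝓑 →L[𝕜] 𝓚) (r : 𝓑 × 𝓑) :
    r ∈ (LinearMap.range
      ((W₂.adjoint.prod W₁.adjoint : 𝓚 →L[𝕜] 𝓑 × 𝓑) : 𝓚 →ₗ[𝕜] 𝓑 × 𝓑)).topologicalClosure ↔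
    ∀ s ∈ LinearMap.ker ((W₁.coprod W₂ : 𝓑 × 𝓑 →L[𝕜] 𝓚) : 𝓑 × 𝓑 →ₗ[𝕜] 𝓚),
      inner 𝕜 s.1 r.2 + inner 𝕜 s.2 r.1 = 0 := by
  -- The orthogonality argument takes place in the Hilbert space `WithLp 2 (𝓑 × 𝓑)`; the swap in
  -- `e` accounts for the crossed indices in Green's identity.
  let e : WithLp 2 (𝓑 × 𝓑) ≃L[𝕜] 𝓑 × 𝓑 :=
    (WithLp.prodContinuousLinearEquiv 2 𝕜 𝓑 𝓑).trans (ContinuousLinearEquiv.prodComm 𝕜 𝓑 𝓑)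
  let W : WithLp 2 (𝓑 × 𝓑) →L[𝕜] 𝓚 :=
    (W₁.coprod W₂).comp (WithLp.prodContinuousLinearEquiv 2 𝕜 𝓑 𝓑 : _ →L[𝕜] 𝓑 × 𝓑)
  have hW (k : 𝓚) : W.adjoint k = WithLp.toLp 2 (W₁.adjoint k, W₂.adjoint k) := by
    refine ext_inner_left 𝕜 fun s => ?_
    rw [ContinuousLinearMap.adjoint_inner_right, WithLp.prod_inner_apply]
    simp [W, inner_add_left, ContinuousLinearMap.adjoint_inner_right]
  have hrange : ((LinearMap.range
      ((W₂.adjoint.prod W₁.adjoint : 𝓚 →L[𝕜] 𝓑 × 𝓑) : 𝓚 →ₗ[𝕜] 𝓑 × 𝓑)) : Set (𝓑 × 𝓑)) =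
      e '' W.adjoint.range := by
    ext p
    constructor
    · rintro ⟨k, rfl⟩
      exact ⟨W.adjoint k, ⟨k, rfl⟩, by rw [hW]; rfl⟩
    · rintro ⟨_, ⟨k, rfl⟩, rfl⟩
      exact ⟨k, by rw [ContinuousLinearMap.coe_coe, ContinuousLinearMap.coe_coe, hW]; rfl⟩
  have hmem : r ∈ (LinearMap.range
      ((W₂.adjoint.prod W₁.adjoint : 𝓚 →L[𝕜] 𝓑 × 𝓑) : 𝓚 →ₗ[𝕜] 𝓑 × 𝓑)).topologicalClosure ↔
      e.symm r ∈ W.kerᗮ := by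
    rw [← SetLike.mem_coe, Submodule.topologicalClosure_coe, hrange,
      ContinuousLinearMap.orthogonal_ker, ← SetLike.mem_coe, Submodule.topologicalClosure_coe,
      ← e.image_closure, e.image_eq_preimage_symm, Set.mem_preimage]
  rw [hmem, Submodule.mem_orthogonal]
  constructor
  · intro h s hs
    have := h (WithLp.toLp 2 s) hs
    rwa [WithLp.prod_inner_apply] at this
  · intro h s hs
    rw [WithLp.prod_inner_apply]
    exact h (WithLp.ofLp s) hs

theorem re_inner_comp_adjoint_add (W₁ W₂ : 𝓑 →L[𝕜] 𝓚) (k : 𝓚) :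
    RCLike.re (inner 𝕜 ((W₁.comp W₂.adjoint + W₂.comp W₁.adjoint) k) k) =
      2 * RCLike.re (inner 𝕜 (W₂.adjoint k) (W₁.adjoint k)) := by
  rw [add_apply, inner_add_left, map_add, ContinuousLinearMap.comp_apply,
    ContinuousLinearMap.comp_apply, ← ContinuousLinearMap.adjoint_inner_right W₁,
    ← ContinuousLinearMap.adjoint_inner_right W₂, inner_re_symm (W₁.adjoint k), two_mul]

theorem isSymmetric_comp_adjoint_add (W₁ W₂ : 𝓑 →L[𝕜] 𝓚) :
    (W₁.comp W₂.adjoint + W₂.comp W₁.adjoint : 𝓚 →L[𝕜] 𝓚).IsSymmetric := by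
  intro x y
  change inner 𝕜 (W₁ (W₂.adjoint x) + W₂ (W₁.adjoint x)) y =
    inner 𝕜 x (W₁ (W₂.adjoint y) + W₂ (W₁.adjoint y))
  rw [inner_add_left, inner_add_right, ← ContinuousLinearMap.adjoint_inner_right W₁,
    ← ContinuousLinearMap.adjoint_inner_right W₂, ← ContinuousLinearMap.adjoint_inner_left W₁,
    ← ContinuousLinearMap.adjoint_inner_left W₂, add_comm]

theorem isPositive_comp_adjoint_add_iff (W₁ W₂ : 𝓑 →L[𝕜] 𝓚) :
    (W₁.comp W₂.adjoint + W₂.comp W₁.adjoint).IsPositive ↔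
      ∀ r ∈ (LinearMap.range ((W₂.adjoint.prod W₁.adjoint : 𝓚 →L[𝕜] 𝓑 × 𝓑) :
        𝓚 →ₗ[𝕜] 𝓑 × 𝓑)).topologicalClosure, 0 ≤ RCLike.re (inner 𝕜 r.1 r.2) := by
  constructor
  · intro h r hr
    refine closure_minimal (t := {r : 𝓑 × 𝓑 | 0 ≤ RCLike.re (inner 𝕜 r.1 r.2)}) ?_
      (isClosed_le continuous_const (by fun_prop)) hr
    rintro _ ⟨k, rfl⟩
    have h1 := h.re_inner_nonneg_left k
    rw [re_inner_comp_adjoint_add] at h1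
    exact nonneg_of_mul_nonneg_right h1 two_pos
  · intro h
    refine ⟨isSymmetric_comp_adjoint_add W₁ W₂, fun k => ?_⟩
    rw [ContinuousLinearMap.reApplyInnerSelf_apply, re_inner_comp_adjoint_add]
    exact mul_nonneg two_pos.le (h _ (Submodule.le_topologicalClosure _ ⟨k, rfl⟩))

theorem comp_adjoint_add_eq_zero_iff (W₁ W₂ : 𝓑 →L[𝕜] 𝓚) :
    W₁.comp W₂.adjoint + W₂.comp W₁.adjoint = 0 ↔
      RelSkewSymmetric (LinearMap.range ((W₂.adjoint.prod W₁.adjoint : 𝓚 →L[𝕜] 𝓑 × 𝓑) :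
        𝓚 →ₗ[𝕜] 𝓑 × 𝓑)).topologicalClosure := by
  constructor
  · intro h r hr
    refine closure_minimal (t := {r : 𝓑 × 𝓑 | RCLike.re (inner 𝕜 r.1 r.2) = 0}) ?_
      (isClosed_eq (by fun_prop) continuous_const) hr
    rintro _ ⟨k, rfl⟩
    have h1 := re_inner_comp_adjoint_add W₁ W₂ k
    rw [h] at h1
    simpa using h1.symm
  · intro h
    have h0 := (isSymmetric_comp_adjoint_add W₁ W₂).inner_map_self_eq_zero.1 fun k => by
      rw [← (isSymmetric_comp_adjoint_add W₁ W₂).coe_re_inner_apply_self]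
      have h1 : RCLike.re (inner 𝕜 (W₂.adjoint k) (W₁.adjoint k)) = 0 :=
        h _ (Submodule.le_topologicalClosure _ ⟨k, rfl⟩)
      rw [ContinuousLinearMap.coe_coe, re_inner_comp_adjoint_add W₁ W₂ k, h1, mul_zero,
        RCLike.ofReal_zero]
    ext k
    exact LinearMap.congr_fun h0 k

end BoundaryOperators

end Triplets

/-! ### Semigroups of bounded dissipative operators -/

section ExpSemigroup

variable {𝕜 : Type*} [RCLike 𝕜]
variable {X : Type*} [NormedAddCommGroup X] [InnerProductSpace 𝕜 X]

/-- The semigroup `t ↦ exp (t B)` generated by a bounded operator `B`, for real `t`. -/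
noncomputable def expSemigroup (B : X →L[𝕜] X) (t : ℝ) : X →L[𝕜] X :=
  NormedSpace.exp ((t : 𝕜) • B)

theorem expSemigroup_zero (B : X →L[𝕜] X) : expSemigroup B 0 = 1 := by
  simp [expSemigroup]

theorem expSemigroup_mul_of_commute [CompleteSpace X] {B C : X →L[𝕜] X} (h : Commute B C)
    (s t : ℝ) :
    expSemigroup B s * expSemigroup C t = NormedSpace.exp ((s : 𝕜) • B + (t : 𝕜) • C) := by
  let : NormedAlgebra ℚ (X →L[𝕜] X) := NormedAlgebra.restrictScalars ℚ 𝕜 _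
  exact (NormedSpace.exp_add_of_commute ((h.smul_left _).smul_right _)).symm

theorem expSemigroup_add [CompleteSpace X] (B : X →L[𝕜] X) (s t : ℝ) :
    expSemigroup B (s + t) = expSemigroup B s * expSemigroup B t := by
  rw [expSemigroup_mul_of_commute (Commute.refl B), expSemigroup, RCLike.ofReal_add, add_smul]

theorem hasDerivAt_expSemigroup [CompleteSpace X] [NormedSpace ℝ X] [IsScalarTower ℝ 𝕜 X]
    (B : X →L[𝕜] X) (x : X) (t : ℝ) :
    HasDerivAt (fun s => expSemigroup B s x) (expSemigroup B t (B x)) t := by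
  have h := hasDerivAt_exp_smul_const (𝕂 := 𝕜) B (t : 𝕜)
  have h' := (ContinuousLinearMap.apply 𝕜 X x).hasFDerivAt.comp_hasDerivAt _ h
  simpa [Function.comp_def, expSemigroup] using
    (h'.hasFDerivAt.restrictScalars ℝ).comp_hasDerivAt t (RCLike.ofRealCLM (K := 𝕜)).hasDerivAt

theorem expSemigroup_apply_comm (B : X →L[𝕜] X) (t : ℝ) (x : X) :
    expSemigroup B t (B x) = B (expSemigroup B t x) :=
  congrArg (fun L : X →L[𝕜] X => L x)
    (((Commute.refl B).smul_right ((t : 𝕜))).exp_right.eq.symm)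

/-- Dissipativity makes the energy `‖exp (t B) x‖²` nonincreasing. -/
theorem norm_expSemigroup_apply_le [CompleteSpace X] {B : X →L[𝕜] X}
    (hB : ∀ x, RCLike.re (inner 𝕜 x (B x)) ≤ 0) {t : ℝ} (ht : 0 ≤ t) (x : X) :
    ‖expSemigroup B t x‖ ≤ ‖x‖ := by
  let : NormedSpace ℝ X := NormedSpace.restrictScalars ℝ 𝕜 X
  have : IsScalarTower ℝ 𝕜 X := ⟨fun a b x => by rw [← smul_assoc]⟩
  have hder (s : ℝ) : HasDerivAt (fun s => ‖expSemigroup B s x‖ ^ 2)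
      (2 * RCLike.re (inner 𝕜 (expSemigroup B s x) (B (expSemigroup B s x)))) s := by
    have h1 := hasDerivAt_expSemigroup B x s
    rw [expSemigroup_apply_comm] at h1
    have h2 := (RCLike.reCLM (K := 𝕜)).hasFDerivAt.comp_hasDerivAt s (h1.inner 𝕜 h1)
    have h3 : ∀ y : X, RCLike.re (inner 𝕜 y y) = ‖y‖ ^ 2 := fun y => inner_self_eq_norm_sq y
    simpa [Function.comp_def, h3, inner_re_symm (B _), two_mul] using h2
  have hanti : Antitone fun s => ‖expSemigroup B s x‖ ^ 2 := by
    refine antitone_of_deriv_nonpos (fun s => (hder s).differentiableAt) fun s => ?_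
    rw [(hder s).deriv]
    exact mul_nonpos_of_nonneg_of_nonpos two_pos.le (hB _)
  have h := hanti ht
  simp only [expSemigroup_zero, one_apply_eq_self] at h
  exact (sq_le_sq₀ (norm_nonneg _) (norm_nonneg _)).1 h

theorem norm_sub_le_of_hasDerivAt [NormedSpace ℝ X] {f f' : ℝ → X} {C t : ℝ} (ht : 0 ≤ t)
    (hf : ∀ s, HasDerivAt f (f' s) s) (hC : ∀ s, 0 ≤ s → s ≤ t → ‖f' s‖ ≤ C) :
    ‖f t - f 0‖ ≤ t * C := by
  have h := Convex.norm_image_sub_le_of_norm_hasDerivWithin_le (s := Set.Icc 0 t) (C := C)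
    (fun s _ => (hf s).hasDerivWithinAt) (fun s hs => hC s hs.1 hs.2) (convex_Icc 0 t)
    (Set.left_mem_Icc.2 ht) (Set.right_mem_Icc.2 ht)
  rwa [sub_zero, Real.norm_of_nonneg ht, mul_comm] at h

theorem norm_expSemigroup_apply_sub_le [CompleteSpace X] {B : X →L[𝕜] X}
    (hB : ∀ x, RCLike.re (inner 𝕜 x (B x)) ≤ 0) {t : ℝ} (ht : 0 ≤ t) (x : X) :
    ‖expSemigroup B t x - x‖ ≤ t * ‖B x‖ := by
  let : NormedSpace ℝ X := NormedSpace.restrictScalars ℝ 𝕜 X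
  have : IsScalarTower ℝ 𝕜 X := ⟨fun a b x => by rw [← smul_assoc]⟩
  have h := norm_sub_le_of_hasDerivAt ht (hasDerivAt_expSemigroup B x)
    fun s hs _ => norm_expSemigroup_apply_le hB hs (B x)
  simpa [expSemigroup_zero] using h

/-- A bound on the first-order Taylor remainder of `exp (t B) x` at `t = 0`. -/
theorem norm_expSemigroup_apply_sub_sub_le [CompleteSpace X] {B : X →L[𝕜] X} {t C : ℝ}
    (ht : 0 ≤ t) (x : X)
    (hC : ∀ s, 0 ≤ s → s ≤ t → ‖expSemigroup B s (B x) - B x‖ ≤ C) :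
    ‖expSemigroup B t x - x - (t : 𝕜) • B x‖ ≤ t * C := by
  let : NormedSpace ℝ X := NormedSpace.restrictScalars ℝ 𝕜 X
  have : IsScalarTower ℝ 𝕜 X := ⟨fun a b x => by rw [← smul_assoc]⟩
  have h := norm_sub_le_of_hasDerivAt (f := fun s => expSemigroup B s x - s • B x)
    (f' := fun s => expSemigroup B s (B x) - B x) ht
    (fun s => (hasDerivAt_expSemigroup B x s).sub (by
      simpa using (hasDerivAt_id s).smul_const (B x))) hC
  simp only [expSemigroup_zero, one_apply_eq_self, zero_smul, sub_zero] at h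
  rwa [sub_right_comm, RCLike.real_smul_eq_coe_smul (K := 𝕜)] at h

/-- For commuting dissipative generators, `s ↦ exp ((t - s) B) exp (s C) x` interpolates between
`exp (t B) x` and `exp (t C) x`, with derivative `exp ((t - s) B) exp (s C) (C - B) x`. -/
theorem norm_expSemigroup_sub_le [CompleteSpace X] {B C : X →L[𝕜] X} (hBC : Commute B C)
    (hB : ∀ x, RCLike.re (inner 𝕜 x (B x)) ≤ 0) (hC : ∀ x, RCLike.re (inner 𝕜 x (C x)) ≤ 0)
    {t : ℝ} (ht : 0 ≤ t) (x : X) :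
    ‖expSemigroup C t x - expSemigroup B t x‖ ≤ t * ‖C x - B x‖ := by
  let : NormedSpace ℝ X := NormedSpace.restrictScalars ℝ 𝕜 X
  have : IsScalarTower ℝ 𝕜 X := ⟨fun a b x => by rw [← smul_assoc]⟩
  have hcomm : Commute B (C - B) := hBC.sub_right (Commute.refl B)
  have key (s : ℝ) :
      expSemigroup B t * expSemigroup (C - B) s = expSemigroup B (t - s) * expSemigroup C s := by
    rw [expSemigroup_mul_of_commute hcomm, expSemigroup_mul_of_commute hBC]
    congr 1
    rw [RCLike.ofReal_sub, sub_smul, smul_sub]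
    abel
  have key' (s : ℝ) (y : X) : expSemigroup B t (expSemigroup (C - B) s y) =
      expSemigroup B (t - s) (expSemigroup C s y) :=
    congrArg (fun L : X →L[𝕜] X => L y) (key s)
  have h := norm_sub_le_of_hasDerivAt (C := ‖C x - B x‖) ht
    (fun s => ((expSemigroup B t).restrictScalars ℝ).hasFDerivAt.comp_hasDerivAt s
      (hasDerivAt_expSemigroup (C - B) x s)) fun s hs hst => by
    simp only [ContinuousLinearMap.coe_restrictScalars', key']
    exact (norm_expSemigroup_apply_le hB (sub_nonneg.2 hst) _).trans
      (norm_expSemigroup_apply_le hC hs _)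
  simpa [Function.comp_def, key', expSemigroup_zero] using h

end ExpSemigroup

/-! ### Resolvents and Yosida approximations -/

section Resolvent

variable {𝕜 : Type*} [RCLike 𝕜]
variable {X : Type*} [NormedAddCommGroup X] [InnerProductSpace 𝕜 X]

theorem norm_sq_add_le_of_re_inner_nonpos {x z : X} (hxz : RCLike.re (inner 𝕜 x z) ≤ 0) {h : ℝ}
    (hh : 0 ≤ h) : ‖x‖ ^ 2 + (h * ‖z‖) ^ 2 ≤ ‖x - (h : 𝕜) • z‖ ^ 2 := by
  rw [@norm_sub_sq 𝕜, inner_smul_right, RCLike.re_ofReal_mul, norm_smul, RCLike.norm_ofReal,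
    abs_of_nonneg hh]
  nlinarith [mul_nonpos_of_nonneg_of_nonpos hh hxz]

theorem norm_le_norm_sub_smul {x z : X} (hxz : RCLike.re (inner 𝕜 x z) ≤ 0) {h : ℝ}
    (hh : 0 ≤ h) : ‖x‖ ≤ ‖x - (h : 𝕜) • z‖ := by
  have := norm_sq_add_le_of_re_inner_nonpos hxz hh
  refine (sq_le_sq₀ (norm_nonneg _) (norm_nonneg _)).1 ?_
  linarith [sq_nonneg (h * ‖z‖)]

/-- The range condition: `1 - h A` is onto, because its range is closed by the dissipativity of
`A` and dense by the dissipativity of `A†`. -/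
theorem exists_sub_smul_eq [CompleteSpace X] {A : X →ₗ.[𝕜] X} (hdense : Dense (A.domain : Set X))
    (hclosed : A.IsClosed) (hA : OpDissipative A) (hA' : OpDissipative A.adjoint) {h : ℝ}
    (hh : 0 < h) (y : X) : ∃ x z, (x, z) ∈ A.graph ∧ x - (h : 𝕜) • z = y := by
  let L : A.graph →L[𝕜] X := (ContinuousLinearMap.fst 𝕜 X X -
    (h : 𝕜) • ContinuousLinearMap.snd 𝕜 X X).comp A.graph.subtypeL
  have hL (p : A.graph) : L p = p.1.1 - (h : 𝕜) • p.1.2 := rfl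
  have hanti : AntilipschitzWith (Real.toNNReal (max 1 h⁻¹)) L := by
    refine AddMonoidHomClass.antilipschitz_of_bound L fun p => ?_
    have hp := norm_sq_add_le_of_re_inner_nonpos (hA _ p.2) hh.le
    rw [← hL] at hp
    rw [Real.coe_toNNReal _ (by positivity)]
    refine (max_le ?_ ?_ : ‖p.1‖ ≤ _)
    · refine (abs_le_of_sq_le_sq' (a := ‖p.1.1‖) ?_ (norm_nonneg _)).2.trans
        (le_mul_of_one_le_left (norm_nonneg _) (le_max_left _ _))
      linarith [sq_nonneg (h * ‖p.1.2‖)]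
    · have h1 : h * ‖p.1.2‖ ≤ ‖L p‖ := by
        refine (abs_le_of_sq_le_sq' ?_ (norm_nonneg _)).2
        linarith [sq_nonneg ‖p.1.1‖]
      calc ‖p.1.2‖ = h⁻¹ * (h * ‖p.1.2‖) := by field_simp
        _ ≤ h⁻¹ * ‖L p‖ := by gcongr
        _ ≤ max 1 h⁻¹ * ‖L p‖ := by gcongr; exact le_max_right _ _
  have : CompleteSpace A.graph := hclosed.completeSpace_coe
  have hcl : IsClosed (L.range : Set X) := hanti.isClosed_range L.uniformContinuous
  have : CompleteSpace L.range := hcl.completeSpace_coe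
  have hbot : L.rangeᗮ = ⊥ := by
    rw [Submodule.eq_bot_iff]
    intro v hv
    have hv' : (v, (h : 𝕜)⁻¹ • v) ∈ A.adjoint.graph := by
      rw [mem_graph_adjoint_iff hdense]
      intro a b hab
      have := (Submodule.mem_orthogonal _ _).1 hv _ ⟨⟨(a, b), hab⟩, rfl⟩
      have h2 : inner 𝕜 (a - (h : 𝕜) • b) v = 0 := this
      rw [inner_sub_left, inner_smul_left, RCLike.conj_ofReal, sub_eq_zero] at h2
      rw [inner_smul_right, h2, inv_mul_cancel_left₀ (by exact_mod_cast hh.ne')]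
    have h3 := hA' _ hv'
    rw [← RCLike.ofReal_inv, inner_smul_right, RCLike.re_ofReal_mul, inner_self_eq_norm_sq] at h3
    have h4 : ‖v‖ ^ 2 ≤ 0 := nonpos_of_mul_nonpos_right h3 (inv_pos.2 hh)
    exact norm_eq_zero.1 (pow_eq_zero_iff two_ne_zero |>.1 (le_antisymm h4 (sq_nonneg _)))
  have htop : L.range = ⊤ := Submodule.orthogonal_eq_bot_iff.1 hbot
  obtain ⟨p, hp⟩ : y ∈ L.range := htop ▸ Submodule.mem_top
  exact ⟨p.1.1, p.1.2, p.2, hp⟩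

/-- The resolvent `(1 - h A)⁻¹` as a contraction. -/
theorem exists_resolvent {A : X →ₗ.[𝕜] X} (hA : OpDissipative A) {h : ℝ} (hh : 0 < h)
    (hsurj : ∀ y, ∃ x z, (x, z) ∈ A.graph ∧ x - (h : 𝕜) • z = y) :
    ∃ J : X →L[𝕜] X, (∀ y, ‖J y‖ ≤ ‖y‖) ∧
      (∀ y, (J y, (h : 𝕜)⁻¹ • (J y - y)) ∈ A.graph) ∧
      ∀ x z, (x, z) ∈ A.graph → J (x - (h : 𝕜) • z) = x := by
  have hh' : (h : 𝕜) ≠ 0 := by exact_mod_cast hh.ne'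
  choose J Z hJ hJZ using hsurj
  -- Dissipativity makes `1 - h A` injective, hence the chosen solutions depend linearly on `y`.
  have huniq {x z y : X} (hxz : (x, z) ∈ A.graph) (hy : x - (h : 𝕜) • z = y) : J y = x := by
    have h1 := A.graph.sub_mem (hJ y) hxz
    have h2 := norm_le_norm_sub_smul (hA _ h1) hh.le
    have h3 : (J y - x) - (h : 𝕜) • (Z y - z) = 0 := by
      rw [smul_sub, sub_sub_sub_comm, hJZ, hy, sub_self]
    rw [Prod.mk_sub_mk, h3, norm_zero] at h2
    exact sub_eq_zero.1 (norm_le_zero_iff.1 h2)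
  let J' : X →ₗ[𝕜] X :=
    { toFun := J
      map_add' := fun y y' => huniq (A.graph.add_mem (hJ y) (hJ y')) (by
        rw [smul_add, add_sub_add_comm]
        exact congrArg₂ _ (hJZ y) (hJZ y'))
      map_smul' := fun c y => huniq (A.graph.smul_mem c (hJ y)) (by
        change c • J y - (h : 𝕜) • c • Z y = c • y
        rw [smul_comm, ← smul_sub, hJZ]) }
  have hbound (y : X) : ‖J y‖ ≤ ‖y‖ := by
    conv_rhs => rw [← hJZ y]
    exact norm_le_norm_sub_smul (hA _ (hJ y)) hh.le
  have hbound' (y : X) : ‖J' y‖ ≤ 1 * ‖y‖ := (hbound y).trans_eq (one_mul _).symm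
  refine ⟨J'.mkContinuous 1 hbound', hbound, fun y => ?_, fun x z hxz => huniq hxz rfl⟩
  change (J y, (h : 𝕜)⁻¹ • (J y - y)) ∈ A.graph
  have hZ : J y - y = (h : 𝕜) • Z y := by
    rw [sub_eq_iff_eq_add, add_comm, ← sub_eq_iff_eq_add, hJZ]
  rw [hZ, inv_smul_smul₀ hh']
  exact hJ y

/-- Resolvents commute; here `J = (1 - h A)⁻¹` and `K = (1 - k A)⁻¹`. -/
theorem commute_resolvent {A : X →ₗ.[𝕜] X} {h k : ℝ} (hh : 0 < h) (hk : 0 < k)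
    {J K : X →L[𝕜] X}
    (hJ : ∀ y, (J y, (h : 𝕜)⁻¹ • (J y - y)) ∈ A.graph)
    (hJ' : ∀ x z, (x, z) ∈ A.graph → J (x - (h : 𝕜) • z) = x)
    (hK : ∀ y, (K y, (k : 𝕜)⁻¹ • (K y - y)) ∈ A.graph)
    (hK' : ∀ x z, (x, z) ∈ A.graph → K (x - (k : 𝕜) • z) = x) : Commute J K := by
  have hh' : (h : 𝕜) ≠ 0 := by exact_mod_cast hh.ne'
  have hk' : (k : 𝕜) ≠ 0 := by exact_mod_cast hk.ne'
  ext y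
  change J (K y) = K (J y)
  -- `v = (1 - h A) w` lies in the domain of `A`, and `(1 - k A) v = (1 - h A) (1 - k A) w = y`.
  have hw := hK (J y)
  have hv := A.graph.sub_mem hw
    (A.graph.smul_mem (h * (k : 𝕜)⁻¹) (A.graph.sub_mem hw (hJ y)))
  have hKy := hK' _ _ hv
  have hJw := hJ' _ _ hw
  simp only [Prod.fst_sub, Prod.snd_sub, Prod.smul_fst, Prod.smul_snd] at hKy
  have e₁ : K (J y) - (h * (k : 𝕜)⁻¹) • (K (J y) - J y) - (k : 𝕜) • ((k : 𝕜)⁻¹ • (K (J y) - J y) -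
      (h * (k : 𝕜)⁻¹) • ((k : 𝕜)⁻¹ • (K (J y) - J y) - (h : 𝕜)⁻¹ • (J y - y))) = y := by
    match_scalars <;> field_simp <;> ring
  have e₂ : K (J y) - (h : 𝕜) • (k : 𝕜)⁻¹ • (K (J y) - J y) =
      K (J y) - (h * (k : 𝕜)⁻¹) • (K (J y) - J y) := by rw [smul_smul]
  rw [e₁] at hKy
  rw [e₂, ← hKy] at hJw
  exact hJw

/-- The Yosida approximations `A (1 - A / (n + 1))⁻¹` of `A`. -/
theorem exists_yosida {A : X →ₗ.[𝕜] X} (hdense : Dense (A.domain : Set X))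
    (hA : OpDissipative A)
    (hsurj : ∀ h : ℝ, 0 < h → ∀ y, ∃ x z, (x, z) ∈ A.graph ∧ x - (h : 𝕜) • z = y) :
    ∃ B : ℕ → X →L[𝕜] X, (∀ n x, RCLike.re (inner 𝕜 x (B n x)) ≤ 0) ∧
      (∀ m n, Commute (B m) (B n)) ∧
      (∀ n x z, (x, z) ∈ A.graph → ‖B n x‖ ≤ ‖z‖) ∧
      ∀ x z, (x, z) ∈ A.graph → Tendsto (fun n => B n x) atTop (𝓝 z) := by
  let h : ℕ → ℝ := fun n => 1 / ((n : ℝ) + 1)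
  have hpos (n : ℕ) : 0 < h n := Nat.one_div_pos_of_nat
  have hh' (n : ℕ) : (h n : 𝕜) ≠ 0 := by exact_mod_cast (hpos n).ne'
  choose J hJ1 hJ2 hJ3 using fun n => exists_resolvent hA (hpos n) (hsurj _ (hpos n))
  have hB (n : ℕ) (x z : X) (hxz : (x, z) ∈ A.graph) :
      ((h n : 𝕜)⁻¹ • (J n - 1)) x = J n z := by
    have h1 := hJ3 n x z hxz
    rw [map_sub, map_smul, sub_eq_iff_eq_add, add_comm, ← sub_eq_iff_eq_add] at h1
    change (h n : 𝕜)⁻¹ • (J n x - x) = J n z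
    rw [h1, inv_smul_smul₀ (hh' n)]
  refine ⟨fun n => (h n : 𝕜)⁻¹ • (J n - 1), fun n x => ?_, fun m n => ?_, fun n x z hxz => ?_,
    fun x z hxz => ?_⟩
  · change RCLike.re (inner 𝕜 x ((h n : 𝕜)⁻¹ • (J n x - x))) ≤ 0
    rw [← RCLike.ofReal_inv, inner_smul_right, RCLike.re_ofReal_mul, inner_sub_right, map_sub,
      inner_self_eq_norm_sq]
    refine mul_nonpos_of_nonneg_of_nonpos (inv_nonneg.2 (hpos n).le) (sub_nonpos.2 ?_)
    calc RCLike.re (inner 𝕜 x (J n x)) ≤ ‖x‖ * ‖J n x‖ := re_inner_le_norm _ _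
      _ ≤ ‖x‖ * ‖x‖ := by gcongr; exact hJ1 n x
      _ = ‖x‖ ^ 2 := (sq _).symm
  · have := commute_resolvent (hpos m) (hpos n) (hJ2 m) (hJ3 m) (hJ2 n) (hJ3 n)
    exact ((this.sub_left (Commute.one_left _)).sub_right
      (Commute.one_right _)).smul_left _ |>.smul_right _
  · rw [hB n x z hxz]
    exact hJ1 n z
  · simp only [hB _ x z hxz]
    -- `J n → 1` strongly: the rate is `h n * ‖A w‖` on the dense domain, and `‖J n‖ ≤ 1`.
    rw [Metric.tendsto_atTop]
    intro ε hε
    obtain ⟨w, hw, hzw⟩ := Metric.dense_iff.1 hdense z (ε / 4) (by positivity)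
    obtain ⟨v, hv⟩ := LinearPMap.mem_domain_iff.1 hzw
    rw [Metric.mem_ball, dist_eq_norm] at hw
    have hlim : Tendsto (fun n => h n * ‖v‖) atTop (𝓝 0) := by
      simpa [h] using tendsto_one_div_add_atTop_nhds_zero_nat.mul_const ‖v‖
    obtain ⟨N, hN⟩ := eventually_atTop.1 (hlim.eventually_lt_const (show 0 < ε / 2 by positivity))
    refine ⟨N, fun n hn => ?_⟩
    have h1 : ‖J n w - w‖ ≤ h n * ‖v‖ := by
      have h2 := hB n w v hv
      change (h n : 𝕜)⁻¹ • (J n w - w) = J n v at h2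
      rw [inv_smul_eq_iff₀ (hh' n)] at h2
      rw [h2, norm_smul, RCLike.norm_ofReal, abs_of_pos (hpos n)]
      exact mul_le_mul_of_nonneg_left (hJ1 n v) (hpos n).le
    have h3 : J n z - z = (J n w - w) - (J n (w - z) - (w - z)) := by
      rw [map_sub]
      abel
    rw [dist_eq_norm, h3]
    calc ‖(J n w - w) - (J n (w - z) - (w - z))‖
        ≤ ‖J n w - w‖ + (‖J n (w - z)‖ + ‖w - z‖) :=
          (norm_sub_le _ _).trans (by gcongr; exact norm_sub_le _ _)
      _ < ε := by linarith [hN n hn, hJ1 n (w - z)]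

end Resolvent

/-! ### Generation of contraction semigroups -/

section Generation

variable {𝕜 : Type*} [RCLike 𝕜]
variable {X : Type*} [NormedAddCommGroup X] [InnerProductSpace 𝕜 X]

/-- Joint continuity of evaluation, along a family of contractions with the strong topology. -/
theorem tendsto_apply_of_norm_le {ι : Type*} {l : Filter ι} {F : ι → X →L[𝕜] X} {w : ι → X}
    {z y : X} (hF : ∀ i x, ‖F i x‖ ≤ ‖x‖) (hz : Tendsto (fun i => F i z) l (𝓝 y))
    (hw : Tendsto w l (𝓝 z)) : Tendsto (fun i => F i (w i)) l (𝓝 y) := by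
  have h1 : Tendsto (fun i => F i (w i - z)) l (𝓝 0) :=
    squeeze_zero_norm (fun i => hF i _) (tendsto_iff_norm_sub_tendsto_zero.1 hw)
  have h2 := h1.add hz
  rw [zero_add] at h2
  refine h2.congr fun i => ?_
  rw [map_sub, sub_add_cancel]

theorem IsContractionSemigroup.norm_apply_le {T : ℝ≥0 → X →L[𝕜] X}
    (hT : IsContractionSemigroup T) (t : ℝ≥0) (x : X) : ‖T t x‖ ≤ ‖x‖ :=
  ((T t).le_of_opNorm_le (hT.contraction t) x).trans_eq (one_mul _)

theorem IsContractionSemigroup.re_inner_nonpos {T : ℝ≥0 → X →L[𝕜] X}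
    (hT : IsContractionSemigroup T) {x y : X}
    (h : Tendsto (fun t : ℝ≥0 => (((t : ℝ) : 𝕜)⁻¹) • (T t x - x)) (𝓝[>] 0) (𝓝 y)) :
    RCLike.re (inner 𝕜 x y) ≤ 0 := by
  have h1 : Tendsto (fun t : ℝ≥0 => RCLike.re (inner 𝕜 x ((((t : ℝ) : 𝕜)⁻¹) • (T t x - x))))
      (𝓝[>] 0) (𝓝 (RCLike.re (inner 𝕜 x y))) :=
    (RCLike.continuous_re.tendsto _).comp (tendsto_const_nhds.inner h)
  refine le_of_tendsto' h1 fun t => ?_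
  rw [← RCLike.ofReal_inv, inner_smul_right, RCLike.re_ofReal_mul, inner_sub_right, map_sub,
    inner_self_eq_norm_sq]
  refine mul_nonpos_of_nonneg_of_nonpos (inv_nonneg.2 t.2) (sub_nonpos.2 ?_)
  calc RCLike.re (inner 𝕜 x (T t x)) ≤ ‖x‖ * ‖T t x‖ := re_inner_le_norm _ _
    _ ≤ ‖x‖ * ‖x‖ := by gcongr; exact hT.norm_apply_le t x
    _ = ‖x‖ ^ 2 := (sq _).symm

theorem GeneratesContractionSemigroup.opDissipative {A : X →ₗ.[𝕜] X}
    (h : GeneratesContractionSemigroup A) : OpDissipative A := by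
  obtain ⟨T, hT, hA⟩ := h
  exact opDissipative_iff.2 fun x y hxy => hT.re_inner_nonpos ((hA x y).1 hxy)

variable [CompleteSpace X]

/-- The strong limit of the exponentials of the Yosida approximations. -/
theorem exists_tendsto_expSemigroup {A : X →ₗ.[𝕜] X} (hdense : Dense (A.domain : Set X))
    {B : ℕ → X →L[𝕜] X} (hdiss : ∀ n x, RCLike.re (inner 𝕜 x (B n x)) ≤ 0)
    (hcomm : ∀ m n, Commute (B m) (B n))
    (hlim : ∀ x z, (x, z) ∈ A.graph → Tendsto (fun n => B n x) atTop (𝓝 z))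
    {t : ℝ} (ht : 0 ≤ t) :
    ∃ T : X →L[𝕜] X, ∀ x, Tendsto (fun n => expSemigroup (B n) t x) atTop (𝓝 (T x)) := by
  have hcauchy (x : X) : ∃ y, Tendsto (fun n => expSemigroup (B n) t x) atTop (𝓝 y) := by
    refine cauchySeq_tendsto_of_complete (Metric.cauchySeq_iff'.2 fun ε hε => ?_)
    obtain ⟨w, hw, hwA⟩ := Metric.dense_iff.1 hdense x (ε / 3) (by positivity)
    obtain ⟨v, hv⟩ := LinearPMap.mem_domain_iff.1 hwA
    rw [Metric.mem_ball, dist_eq_norm] at hw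
    obtain ⟨N, hN⟩ := Metric.cauchySeq_iff'.1 (hlim w v hv).cauchySeq (ε / 3 / (t + 1))
      (by positivity)
    refine ⟨N, fun n hn => ?_⟩
    have h1 := norm_expSemigroup_sub_le (hcomm N n) (hdiss N) (hdiss n) ht w
    have h2 : t * ‖B n w - B N w‖ ≤ ε / 3 := by
      have := (hN n hn).le
      rw [dist_eq_norm, le_div_iff₀ (by positivity)] at this
      nlinarith [norm_nonneg (B n w - B N w)]
    have h3 : expSemigroup (B n) t x - expSemigroup (B N) t x =
        (expSemigroup (B n) t w - expSemigroup (B N) t w) -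
          (expSemigroup (B n) t (w - x) - expSemigroup (B N) t (w - x)) := by
      rw [map_sub, map_sub]
      abel
    have h4 := norm_expSemigroup_apply_le (hdiss n) ht (w - x)
    have h5 := norm_expSemigroup_apply_le (hdiss N) ht (w - x)
    rw [dist_eq_norm, h3]
    calc _ ≤ ‖expSemigroup (B n) t w - expSemigroup (B N) t w‖ +
          (‖expSemigroup (B n) t (w - x)‖ + ‖expSemigroup (B N) t (w - x)‖) :=
          (norm_sub_le _ _).trans (by gcongr; exact norm_sub_le _ _)
      _ < ε := by linarith
  choose f hf using hcauchy
  exact ⟨continuousLinearMapOfTendsto (fun n => expSemigroup (B n) t)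
    (tendsto_pi_nhds.2 hf), hf⟩

/-- The Hille-Yosida theorem for dissipative operators: the semigroup is the strong limit of
`exp (t B n)`, where `B n` are the Yosida approximations. -/
theorem generatesContractionSemigroup_of_surjective {A : X →ₗ.[𝕜] X}
    (hdense : Dense (A.domain : Set X)) (hA : OpDissipative A)
    (hsurj : ∀ h : ℝ, 0 < h → ∀ y, ∃ x z, (x, z) ∈ A.graph ∧ x - (h : 𝕜) • z = y) :
    GeneratesContractionSemigroup A := by
  obtain ⟨B, hdiss, hcomm, hbd, hlim⟩ := exists_yosida hdense hA hsurj
  choose T hT using fun t : ℝ≥0 => exists_tendsto_expSemigroup hdense hdiss hcomm hlim t.2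
  change ∀ (t : ℝ≥0) (x : X), Tendsto (fun n => expSemigroup (B n) t x) atTop (𝓝 (T t x)) at hT
  have hcontr (t : ℝ≥0) (x : X) : ‖T t x‖ ≤ ‖x‖ :=
    le_of_tendsto' (hT t x).norm fun n => norm_expSemigroup_apply_le (hdiss n) t.2 x
  have hzero : T 0 = ContinuousLinearMap.id 𝕜 X := by
    ext x
    refine tendsto_nhds_unique (hT 0 x) (tendsto_const_nhds.congr fun n => ?_)
    simp [expSemigroup_zero]
  have hadd (s t : ℝ≥0) : T (s + t) = (T s).comp (T t) := by
    ext x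
    refine tendsto_nhds_unique (hT (s + t) x) ?_
    refine (tendsto_apply_of_norm_le (fun n y => norm_expSemigroup_apply_le (hdiss n) s.2 y)
      (hT s (T t x)) (hT t x)).congr fun n => ?_
    rw [NNReal.coe_add, expSemigroup_add]
    rfl
  have hsmall (t : ℝ≥0) (x z : X) (hxz : (x, z) ∈ A.graph) : ‖T t x - x‖ ≤ t * ‖z‖ := by
    refine le_of_tendsto' ((hT t x).sub_const x).norm fun n => ?_
    refine (norm_expSemigroup_apply_sub_le (hdiss n) t.2 x).trans ?_
    exact mul_le_mul_of_nonneg_left (hbd n x z hxz) t.2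
  have hLip (x z : X) (hxz : (x, z) ∈ A.graph) (s t : ℝ≥0) (hst : s ≤ t) :
      dist (T s x) (T t x) ≤ ‖z‖ * dist s t := by
    obtain ⟨r, rfl⟩ := exists_add_of_le hst
    rw [hadd, dist_comm, dist_eq_norm, ContinuousLinearMap.comp_apply, ← map_sub, mul_comm]
    refine (hcontr s _).trans ((hsmall r x z hxz).trans_eq ?_)
    simp [NNReal.dist_eq]
  have hcontA (x z : X) (hxz : (x, z) ∈ A.graph) : Continuous fun t => T t x := by
    refine (LipschitzWith.of_dist_le_mul (K := ‖z‖₊) fun s t => ?_).continuous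
    rcases le_total s t with hst | hst
    · exact hLip x z hxz s t hst
    · rw [dist_comm, dist_comm s]
      exact hLip x z hxz t s hst
  have hcont (x : X) : Continuous fun t => T t x := by
    refine continuous_of_uniform_approx_of_continuous fun u hu => ?_
    obtain ⟨ε, hε, hu⟩ := Metric.mem_uniformity_dist.1 hu
    obtain ⟨w, hw, hwA⟩ := Metric.dense_iff.1 hdense x ε hε
    obtain ⟨v, hv⟩ := LinearPMap.mem_domain_iff.1 hwA
    refine ⟨_, hcontA w v hv, fun t => hu ?_⟩
    rw [dist_eq_norm, ← map_sub]
    rw [Metric.mem_ball', dist_eq_norm] at hw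
    exact (hcontr t _).trans_lt hw
  have hSG : IsContractionSemigroup T := ⟨hzero, hadd, hcont, fun t =>
    ContinuousLinearMap.opNorm_le_bound _ zero_le_one fun x => by simpa using hcontr t x⟩
  have hgen (x z : X) (hxz : (x, z) ∈ A.graph) :
      Tendsto (fun t : ℝ≥0 => (((t : ℝ) : 𝕜)⁻¹) • (T t x - x)) (𝓝[>] 0) (𝓝 z) := by
    rw [Metric.tendsto_nhdsWithin_nhds]
    intro ε hε
    obtain ⟨w, hw, hwA⟩ := Metric.dense_iff.1 hdense z (ε / 4) (by positivity)
    obtain ⟨v, hv⟩ := LinearPMap.mem_domain_iff.1 hwA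
    rw [Metric.mem_ball, dist_eq_norm] at hw
    refine ⟨ε / 4 / (‖v‖ + 1), by positivity, fun t ht htδ => ?_⟩
    have ht' : (0 : ℝ) < t := ht
    have htv : t * ‖v‖ ≤ ε / 4 := by
      rw [NNReal.dist_eq, NNReal.coe_zero, sub_zero, abs_of_pos ht',
        lt_div_iff₀ (by positivity)] at htδ
      nlinarith
    -- The integrand `exp (s B n) (B n x) - B n x` is small for `s ≤ t`, uniformly in large `n`.
    have key : ‖T t x - x - (((t : ℝ)) : 𝕜) • z‖ ≤ t * (2 * ‖w - z‖ + t * ‖v‖) := by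
      have hC : Tendsto (fun n => (t : ℝ) * (2 * ‖w - B n x‖ + t * ‖v‖)) atTop
          (𝓝 (t * (2 * ‖w - z‖ + t * ‖v‖))) :=
        (((((hlim x z hxz).const_sub w).norm).const_mul 2).add_const _).const_mul _
      refine le_of_tendsto_of_tendsto' (((hT t x).sub_const x).sub
        ((hlim x z hxz).const_smul _)).norm hC fun n => ?_
      refine norm_expSemigroup_apply_sub_sub_le t.2 x fun s hs hst => ?_
      have h1 : expSemigroup (B n) s (B n x) - B n x = (expSemigroup (B n) s w - w) -
          (expSemigroup (B n) s (w - B n x) - (w - B n x)) := by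
        rw [map_sub]
        abel
      have h2 := norm_expSemigroup_apply_le (hdiss n) hs (w - B n x)
      have h3 : ‖expSemigroup (B n) s w - w‖ ≤ t * ‖v‖ :=
        (norm_expSemigroup_apply_sub_le (hdiss n) hs w).trans
          (mul_le_mul hst (hbd n w v hv) (norm_nonneg _) t.2)
      rw [h1]
      calc _ ≤ ‖expSemigroup (B n) s w - w‖ +
            (‖expSemigroup (B n) s (w - B n x)‖ + ‖w - B n x‖) :=
            (norm_sub_le _ _).trans (by gcongr; exact norm_sub_le _ _)
        _ ≤ _ := by linarith
    have hne : (((t : ℝ)) : 𝕜) ≠ 0 := by exact_mod_cast ht'.ne'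
    have h4 : (((t : ℝ) : 𝕜)⁻¹) • (T t x - x) - z =
        (((t : ℝ) : 𝕜)⁻¹) • (T t x - x - (((t : ℝ)) : 𝕜) • z) := by
      rw [smul_sub _ _ (_ • z), inv_smul_smul₀ hne]
    rw [dist_eq_norm, h4, norm_smul, norm_inv, RCLike.norm_ofReal, abs_of_pos ht',
      inv_mul_lt_iff₀ ht']
    refine key.trans_lt (mul_lt_mul_of_pos_left ?_ ht')
    linarith
  refine ⟨T, hSG, fun x y => ⟨hgen x y, fun h => ?_⟩⟩
  -- The generator is dissipative and extends `A`, while `1 - A` is onto.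
  obtain ⟨x', z', hxz', he⟩ := hsurj 1 one_pos (x - y)
  have h1 : Tendsto (fun t : ℝ≥0 => (((t : ℝ) : 𝕜)⁻¹) • (T t (x - x') - (x - x')))
      (𝓝[>] 0) (𝓝 (y - z')) := by
    refine (h.sub (hgen x' z' hxz')).congr fun t => ?_
    rw [map_sub, ← smul_sub]
    congr 1
    abel
  have h2 := hSG.re_inner_nonpos h1
  have h3 : y - z' = x - x' := by
    rw [RCLike.ofReal_one, one_smul] at he
    rw [sub_eq_sub_iff_add_eq_add] at he ⊢
    rw [add_comm y, he, add_comm] 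
  rw [h3, inner_self_eq_norm_sq] at h2
  have h4 : x - x' = 0 :=
    norm_eq_zero.1 (pow_eq_zero_iff two_ne_zero |>.1 (le_antisymm h2 (sq_nonneg _)))
  rw [h4, sub_eq_zero] at h3
  rw [sub_eq_zero.1 h4, h3]
  exact hxz'

/-- The integral `∫₀ʰ T s x` lies in the domain of the generator, which maps it to `T h x - x`. -/
theorem IsContractionSemigroup.tendsto_integral [NormedSpace ℝ X] [IsScalarTower ℝ 𝕜 X]
    {T : ℝ≥0 → X →L[𝕜] X} (hT : IsContractionSemigroup T) (x : X) (h : ℝ≥0) :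
    Tendsto (fun t : ℝ≥0 => (((t : ℝ) : 𝕜)⁻¹) •
      (T t (∫ s in (0 : ℝ)..h, T s.toNNReal x) - ∫ s in (0 : ℝ)..h, T s.toNNReal x))
      (𝓝[>] 0) (𝓝 (T h x - x)) := by
  have hf : Continuous fun s : ℝ => T s.toNNReal x :=
    (hT.continuous_orbit x).comp continuous_real_toNNReal
  set f : ℝ → X := fun s => T s.toNNReal x with hfdef
  set F : ℝ → X := fun u => ∫ s in (0 : ℝ)..u, f s with hF
  have hint (a b : ℝ) : IntervalIntegrable f MeasureTheory.volume a b := hf.intervalIntegrable a b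
  have hder (u : ℝ) : HasDerivAt F (f u) u :=
    intervalIntegral.integral_hasDerivAt_right (hint _ _) (hf.stronglyMeasurableAtFilter _ _)
      hf.continuousAt
  have hG : HasDerivAt (fun t => F (h + t) - F t) (T h x - x) 0 := by
    have h1 : HasDerivAt (fun t => F (h + t)) (f h) 0 := by
      have := hder (h + 0)
      rw [add_zero] at this
      exact HasDerivAt.comp_const_add (h : ℝ) 0 (by simpa using this)
    have h2 : HasDerivAt (fun t => F (h + t) - F t) (f h - f 0) 0 := h1.sub (hder 0)
    simpa [hfdef, hT.map_zero] using h2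
  have hslope := hG.tendsto_slope_zero_right
  have hcoe : Tendsto (fun t : ℝ≥0 => (t : ℝ)) (𝓝[>] 0) (𝓝[>] 0) :=
    tendsto_nhdsWithin_iff.2 ⟨(NNReal.continuous_coe.tendsto' 0 0 rfl).mono_left
      nhdsWithin_le_nhds, eventually_mem_nhdsWithin.mono fun t ht => NNReal.coe_pos.2 ht⟩
  refine (hslope.comp hcoe).congr fun t => ?_
  have hTt : T t (F h) = F (h + t) - F t := by
    rw [hF, ← ContinuousLinearMap.intervalIntegral_comp_comm _ (hint _ _),
      intervalIntegral.integral_interval_sub_left (hint _ _) (hint _ _)]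
    -- On `[0, h]` the truncation `Real.toNNReal` is harmless, as `s` and `s + t` are nonnegative.
    have h1 : ∀ s ∈ Set.uIcc (0 : ℝ) h, T t (f s) = f (s + t) := by
      intro s hs
      rw [Set.uIcc_of_le (NNReal.coe_nonneg h)] at hs
      rw [hfdef]
      simp only
      rw [Real.toNNReal_add hs.1 (NNReal.coe_nonneg t), Real.toNNReal_coe, add_comm, hT.map_add]
      rfl
    rw [intervalIntegral.integral_congr h1, intervalIntegral.integral_comp_add_right, zero_add]
  have hF0 : F 0 = 0 := intervalIntegral.integral_same
  simp only [Function.comp_apply, zero_add, add_zero, hF0, sub_zero]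
  rw [← hTt, RCLike.real_smul_eq_coe_smul (K := 𝕜), RCLike.ofReal_inv]

/-- Pair `T h x - x = A ∫₀ʰ T s x` with `x` in the domain of `A†` and let `h → 0`. -/
theorem GeneratesContractionSemigroup.opDissipative_adjoint {A : X →ₗ.[𝕜] X}
    (hdense : Dense (A.domain : Set X)) (h : GeneratesContractionSemigroup A) :
    OpDissipative A.adjoint := by
  let : NormedSpace ℝ X := NormedSpace.restrictScalars ℝ 𝕜 X
  have : IsScalarTower ℝ 𝕜 X := ⟨fun a b x => by rw [← smul_assoc]⟩
  obtain ⟨T, hT, hA⟩ := h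
  rw [opDissipative_iff]
  intro x y hxy
  rw [mem_graph_adjoint_iff hdense] at hxy
  have hf : Continuous fun s : ℝ => T s.toNNReal x :=
    (hT.continuous_orbit x).comp continuous_real_toNNReal
  have hder : HasDerivAt (fun u => ∫ s in (0 : ℝ)..u, T s.toNNReal x) x 0 := by
    have := intervalIntegral.integral_hasDerivAt_right (hf.intervalIntegrable 0 0)
      (hf.stronglyMeasurableAtFilter _ _) hf.continuousAt
    simpa [hT.map_zero] using this
  have hlim : Tendsto (fun t : ℝ => RCLike.re (inner 𝕜 (t⁻¹ • ∫ s in (0 : ℝ)..t, T s.toNNReal x) y))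
      (𝓝[>] 0) (𝓝 (RCLike.re (inner 𝕜 x y))) := by
    have := hder.tendsto_slope_zero_right
    simp only [zero_add, intervalIntegral.integral_same, sub_zero] at this
    exact (RCLike.continuous_re.tendsto _).comp (this.inner tendsto_const_nhds)
  refine le_of_tendsto hlim (eventually_mem_nhdsWithin.mono fun t ht => ?_)
  have ht0 : (0 : ℝ) < t := ht
  lift t to ℝ≥0 using ht0.le
  have h1 := hxy _ _ ((hA _ _).2 (hT.tendsto_integral x t))
  rw [RCLike.real_smul_eq_coe_smul (K := 𝕜), inner_smul_left, RCLike.conj_ofReal,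
    RCLike.re_ofReal_mul, ← h1, inner_sub_left, map_sub, inner_self_eq_norm_sq]
  refine mul_nonpos_of_nonneg_of_nonpos (inv_nonneg.2 ht0.le) (sub_nonpos.2 ?_)
  calc RCLike.re (inner 𝕜 (T t x) x) ≤ ‖T t x‖ * ‖x‖ := re_inner_le_norm _ _
    _ ≤ ‖x‖ * ‖x‖ := by gcongr; exact hT.norm_apply_le t x
    _ = ‖x‖ ^ 2 := (sq _).symm

/-- The Lumer-Phillips theorem, with the range condition replaced by dissipativity of `A†`. -/
theorem generatesContractionSemigroup_iff {A : X →ₗ.[𝕜] X} (hdense : Dense (A.domain : Set X))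
    (hclosed : A.IsClosed) :
    GeneratesContractionSemigroup A ↔ OpDissipative A ∧ OpDissipative A.adjoint :=
  ⟨fun h => ⟨h.opDissipative, h.opDissipative_adjoint hdense⟩, fun ⟨h, h'⟩ =>
    generatesContractionSemigroup_of_surjective hdense h fun _ hpos =>
      exists_sub_smul_eq hdense hclosed h h' hpos⟩

end Generation

/-! ### Generation of unitary groups -/

section UnitaryGroups

variable {𝕜 : Type*} [RCLike 𝕜]
variable {X : Type*} [NormedAddCommGroup X] [InnerProductSpace 𝕜 X]

theorem tendsto_coe_nhdsGT_zero {α : Type*} {f : ℝ → α} {l : Filter α} :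
    Tendsto (fun t : ℝ≥0 => f t) (𝓝[>] 0) l ↔ Tendsto f (𝓝[>] 0) l := by
  have h : map ((↑) : ℝ≥0 → ℝ) (𝓝[>] 0) = 𝓝[>] 0 := by
    rw [NNReal.isEmbedding_coe.map_nhdsWithin_eq, NNReal.coe_zero]
    congr 1
    ext t
    refine ⟨?_, fun ht => ⟨⟨t, le_of_lt ht⟩, ht, rfl⟩⟩
    rintro ⟨s, hs, rfl⟩
    exact hs
  rw [← h, tendsto_map'_iff]
  rfl

theorem tendsto_neg_nhdsLT_zero {α : Type*} {f : ℝ → α} {l : Filter α} :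
    Tendsto (fun t => f (-t)) (𝓝[>] 0) l ↔ Tendsto f (𝓝[<] 0) l := by
  have h : map (fun t : ℝ => -t) (𝓝[>] 0) = 𝓝[<] 0 := by
    simp
  rw [← h, tendsto_map'_iff]
  rfl

theorem quotient_comp_neg (U : ℝ → X →L[𝕜] X) (x : X) (t : ℝ) :
    ((((-t : ℝ) : 𝕜))⁻¹) • (U (-t) x - x) = -(((t : 𝕜)⁻¹) • (U (-t) x - x)) := by
  rw [RCLike.ofReal_neg, inv_neg, neg_smul]

/-- The left difference quotients of `t ↦ U t x` are the negatives of the right difference quotients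
of `t ↦ U (-t) x`. -/
theorem tendsto_quotient_nhdsLT_iff (U : ℝ → X →L[𝕜] X) (x y : X) :
    Tendsto (fun t : ℝ => ((t : 𝕜)⁻¹) • (U t x - x)) (𝓝[<] 0) (𝓝 y) ↔
      Tendsto (fun t : ℝ => ((t : 𝕜)⁻¹) • (U (-t) x - x)) (𝓝[>] 0) (𝓝 (-y)) := by
  rw [← tendsto_neg_nhdsLT_zero, ← tendsto_neg_iff]
  simp only [quotient_comp_neg, neg_neg]

theorem IsContractionSemigroup.mem_graph_apply {A : X →ₗ.[𝕜] X} {T : ℝ≥0 → X →L[𝕜] X}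
    (hT : IsContractionSemigroup T)
    (hA : ∀ x y : X, (x, y) ∈ A.graph ↔
      Tendsto (fun t : ℝ≥0 => (((t : ℝ) : 𝕜)⁻¹) • (T t x - x)) (𝓝[>] 0) (𝓝 y))
    {x y : X} (hxy : (x, y) ∈ A.graph) (t : ℝ≥0) : (T t x, T t y) ∈ A.graph := by
  rw [hA]
  refine (((T t).continuous.tendsto y).comp ((hA x y).1 hxy)).congr fun s => ?_
  simp only [Function.comp_apply]
  rw [map_smul, map_sub, ← ContinuousLinearMap.comp_apply, ← ContinuousLinearMap.comp_apply,
    ← hT.map_add, ← hT.map_add, add_comm]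

/-- If `T` and `S` are generated by `A` and `-A`, then `S t (T t x)` has vanishing right derivative
for `x` in the domain of `A`, so that `S t` inverts `T t`. -/
theorem IsContractionSemigroup.comp_eq_id {A : X →ₗ.[𝕜] X} (hdense : Dense (A.domain : Set X))
    {T S : ℝ≥0 → X →L[𝕜] X} (hT : IsContractionSemigroup T) (hS : IsContractionSemigroup S)
    (hAT : ∀ x y : X, (x, y) ∈ A.graph ↔
      Tendsto (fun t : ℝ≥0 => (((t : ℝ) : 𝕜)⁻¹) • (T t x - x)) (𝓝[>] 0) (𝓝 y))
    (hAS : ∀ x y : X, (x, y) ∈ (-A).graph ↔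
      Tendsto (fun t : ℝ≥0 => (((t : ℝ) : 𝕜)⁻¹) • (S t x - x)) (𝓝[>] 0) (𝓝 y)) (t : ℝ≥0) :
    S t * T t = 1 := by
  let : NormedSpace ℝ X := NormedSpace.restrictScalars ℝ 𝕜 X
  have : IsScalarTower ℝ 𝕜 X := ⟨fun a b x => by rw [← smul_assoc]⟩
  have hST (x : X) : Continuous fun t => S t (T t x) :=
    continuous_iff_continuousAt.2 fun t => tendsto_apply_of_norm_le hS.norm_apply_le
      ((hS.continuous_orbit _).tendsto t) ((hT.continuous_orbit x).tendsto t)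
  have hzero {x y : X} (hxy : (x, y) ∈ A.graph) :
      Tendsto (fun t : ℝ≥0 => (((t : ℝ) : 𝕜)⁻¹) • (S t (T t x) - x)) (𝓝[>] 0) (𝓝 0) := by
    have h1 : Tendsto (fun t => S t y) (𝓝[>] 0) (𝓝 y) :=
      ((hS.continuous_orbit y).tendsto' 0 y (by simp [hS.map_zero])).mono_left nhdsWithin_le_nhds
    have h2 := tendsto_apply_of_norm_le hS.norm_apply_le h1 ((hAT x y).1 hxy)
    have h3 := h2.add ((hAS x (-y)).1 (mem_graph_neg.2 (by simpa using hxy)))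
    rw [add_neg_cancel] at h3
    refine h3.congr fun t => ?_
    rw [map_smul, map_sub, ← smul_add, sub_add_sub_cancel]
  have hdom {x y : X} (hxy : (x, y) ∈ A.graph) : S t (T t x) = x := by
    have hcont : Continuous fun s : ℝ => S s.toNNReal (T s.toNNReal x) :=
      (hST x).comp continuous_real_toNNReal
    have := constant_of_has_deriv_right_zero (a := 0) (b := t) hcont.continuousOn fun s hs => by
      have hs0 : (0 : ℝ) ≤ s := hs.1
      lift s to ℝ≥0 using hs0
      have hmap : map (fun r => (s : ℝ) + r) (𝓝[>] 0) = 𝓝[>] (s : ℝ) := by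
        simp
      rw [← hasDerivWithinAt_Ioi_iff_Ici, hasDerivWithinAt_iff_tendsto_slope' Set.self_notMem_Ioi,
        ← hmap, tendsto_map'_iff, ← tendsto_coe_nhdsGT_zero]
      have h1 := ((S s).continuous.tendsto 0).comp (hzero (hT.mem_graph_apply hAT hxy s))
      rw [_root_.map_zero] at h1
      refine h1.congr fun r => ?_
      have hTr : T (s + r) x = T r (T s x) := by rw [add_comm, hT.map_add]; rfl
      have hSr (w : X) : S (s + r) w = S s (S r w) := by rw [hS.map_add]; rfl
      simp only [Function.comp_apply, slope_def_module, add_sub_cancel_left]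
      rw [← NNReal.coe_add, Real.toNNReal_coe, Real.toNNReal_coe, hTr, hSr,
        RCLike.real_smul_eq_coe_smul (K := 𝕜), RCLike.ofReal_inv, map_smul, map_sub]
    have := this t (Set.right_mem_Icc.2 t.2)
    simpa [hS.map_zero, hT.map_zero] using this
  ext x
  have hclosed : IsClosed {x | S t (T t x) = x} := isClosed_eq (by fun_prop) continuous_id
  refine hclosed.closure_subset_iff.2 ?_ (hdense x)
  intro w hw
  obtain ⟨v, hv⟩ := LinearPMap.mem_domain_iff.1 hw
  exact hdom hv

variable [CompleteSpace X]

theorem IsUnitaryGroup.norm_apply {U : ℝ → X →L[𝕜] X} (hU : IsUnitaryGroup U) (t : ℝ) (x : X) :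
    ‖U t x‖ = ‖x‖ :=
  ContinuousLinearMap.norm_map_of_mem_unitary (hU.mem_unitary t) x

theorem IsUnitaryGroup.comp_neg {U : ℝ → X →L[𝕜] X} (hU : IsUnitaryGroup U) :
    IsUnitaryGroup fun t => U (-t) where
  map_zero := by rw [neg_zero, hU.map_zero]
  map_add s t := by rw [neg_add, hU.map_add]
  continuous_orbit x := (hU.continuous_orbit x).comp continuous_neg
  mem_unitary t := hU.mem_unitary (-t)

theorem IsUnitaryGroup.isContractionSemigroup {U : ℝ → X →L[𝕜] X} (hU : IsUnitaryGroup U) :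
    IsContractionSemigroup fun t : ℝ≥0 => U t where
  map_zero := hU.map_zero
  map_add s t := by rw [NNReal.coe_add, hU.map_add]
  continuous_orbit x := (hU.continuous_orbit x).comp NNReal.continuous_coe
  contraction t := ContinuousLinearMap.opNorm_le_bound _ zero_le_one fun x => by
    rw [hU.norm_apply, one_mul]

/-- The difference quotients at `-t` and `t` are related by `U (-t)`, which is isometric and
converges strongly to the identity. -/
theorem IsUnitaryGroup.tendsto_nhdsLT {U : ℝ → X →L[𝕜] X} (hU : IsUnitaryGroup U) {x y : X}
    (h : Tendsto (fun t : ℝ => ((t : 𝕜)⁻¹) • (U t x - x)) (𝓝[>] 0) (𝓝 y)) :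
    Tendsto (fun t : ℝ => ((t : 𝕜)⁻¹) • (U t x - x)) (𝓝[<] 0) (𝓝 y) := by
  rw [← tendsto_neg_nhdsLT_zero]
  have h0 : Tendsto (fun t => U (-t) y) (𝓝[>] 0) (𝓝 y) :=
    ((hU.comp_neg.continuous_orbit y).tendsto' 0 y (by simp [hU.map_zero])).mono_left
      nhdsWithin_le_nhds
  refine (tendsto_apply_of_norm_le (fun t x => (hU.norm_apply (-t) x).le) h0 h).congr fun t => ?_
  have h1 : U (-t) (U t x) = x := by
    rw [← ContinuousLinearMap.comp_apply, ← hU.map_add, neg_add_cancel, hU.map_zero]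
    rfl
  rw [map_smul, map_sub, h1, RCLike.ofReal_neg, inv_neg, neg_smul, ← smul_neg, neg_sub]

theorem IsUnitaryGroup.tendsto_nhdsNE_iff {U : ℝ → X →L[𝕜] X} (hU : IsUnitaryGroup U) {x y : X} :
    Tendsto (fun t : ℝ => ((t : 𝕜)⁻¹) • (U t x - x)) (𝓝[≠] 0) (𝓝 y) ↔
      Tendsto (fun t : ℝ => ((t : 𝕜)⁻¹) • (U t x - x)) (𝓝[>] 0) (𝓝 y) := by
  refine ⟨fun h => h.mono_left (nhdsWithin_mono _ fun t ht => ne_of_gt ht), fun h => ?_⟩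
  rw [← nhdsLT_sup_nhdsGT]
  exact (hU.tendsto_nhdsLT h).sup h

theorem IsUnitaryGroup.tendsto_nhdsNE_iff_neg {U : ℝ → X →L[𝕜] X} (hU : IsUnitaryGroup U)
    {x y : X} : Tendsto (fun t : ℝ => ((t : 𝕜)⁻¹) • (U t x - x)) (𝓝[≠] 0) (𝓝 y) ↔
      Tendsto (fun t : ℝ => ((t : 𝕜)⁻¹) • (U (-t) x - x)) (𝓝[>] 0) (𝓝 (-y)) := by
  rw [← tendsto_quotient_nhdsLT_iff, ← nhdsLT_sup_nhdsGT]
  refine ⟨fun h => h.mono_left le_sup_left, fun h => h.sup ?_⟩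
  have h1 := hU.comp_neg.tendsto_nhdsLT ((tendsto_quotient_nhdsLT_iff U x y).1 h)
  rw [tendsto_quotient_nhdsLT_iff (fun t => U (-t))] at h1
  simpa using h1

theorem GeneratesUnitaryGroup.generatesContractionSemigroup {A : X →ₗ.[𝕜] X}
    (h : GeneratesUnitaryGroup A) :
    GeneratesContractionSemigroup A ∧ GeneratesContractionSemigroup (-A) := by
  obtain ⟨U, hU, hA⟩ := h
  refine ⟨⟨fun t => U t, hU.isContractionSemigroup, fun x y => ?_⟩,
    ⟨fun t => U (-t), hU.comp_neg.isContractionSemigroup, fun x y => ?_⟩⟩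
  · rw [hA, hU.tendsto_nhdsNE_iff]
    exact tendsto_coe_nhdsGT_zero.symm
  · rw [mem_graph_neg, hA, hU.tendsto_nhdsNE_iff_neg, neg_neg]
    exact (tendsto_coe_nhdsGT_zero (f := fun t : ℝ => ((t : 𝕜)⁻¹) • (U (-t) x - x))).symm

theorem generatesUnitaryGroup_of_generatesContractionSemigroup {A : X →ₗ.[𝕜] X}
    (hdense : Dense (A.domain : Set X)) (h : GeneratesContractionSemigroup A)
    (h' : GeneratesContractionSemigroup (-A)) : GeneratesUnitaryGroup A := by
  obtain ⟨T, hT, hAT⟩ := h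
  obtain ⟨S, hS, hAS⟩ := h'
  have hST := hT.comp_eq_id hdense hS hAT hAS
  have hTS (t : ℝ≥0) : T t * S t = 1 :=
    hS.comp_eq_id (A := -A) (by simpa using hdense) hT hAS (by simpa using hAT) t
  have hTadd (s t : ℝ≥0) : T (s + t) = T s * T t := hT.map_add s t
  have hSadd (s t : ℝ≥0) : S (s + t) = S s * S t := hS.map_add s t
  have hTT (s t : ℝ≥0) : Commute (T s) (T t) := by
    rw [Commute, SemiconjBy, ← hTadd, ← hTadd, add_comm]
  have hcomm (s t : ℝ≥0) : Commute (S s) (T t) := by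
    calc S s * T t = S s * T t * (T s * S s) := by rw [hTS, mul_one]
      _ = S s * (T t * T s) * S s := by simp only [mul_assoc]
      _ = S s * T s * T t * S s := by rw [(hTT t s).eq]; simp only [mul_assoc]
      _ = T t * S s := by rw [hST, one_mul]
  -- The value at `t` of the group, from any representation of `t` as a difference.
  have hrep {a b c d : ℝ≥0} (habcd : a + d = c + b) : T a * S b = T c * S d := by
    calc T a * S b = T a * (T d * S d) * S b := by rw [hTS, mul_one]
      _ = T (a + d) * (S d * S b) := by rw [hTadd]; simp only [mul_assoc]
      _ = T c * (T b * S b) * S d := by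
        rw [habcd, hTadd, ← hSadd, add_comm d, hSadd]; simp only [mul_assoc]
      _ = T c * S d := by rw [hTS, mul_one]
  -- One of the two factors is always the identity.
  let U : ℝ → X →L[𝕜] X := fun t => T t.toNNReal * S (-t).toNNReal
  have hUadd (s t : ℝ) : U (s + t) = U s * U t := by
    have h1 : U (s + t) = T (s.toNNReal + t.toNNReal) * S ((-s).toNNReal + (-t).toNNReal) := by
      refine hrep (NNReal.eq ?_)
      push_cast
      simp only [Real.coe_toNNReal']
      have e (r : ℝ) : max r 0 - max (-r) 0 = r := max_zero_sub_eq_self r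
      linarith [e s, e t, e (s + t)]
    rw [h1, hTadd, hSadd]
    simp only [U]
    calc _ = T s.toNNReal * (T t.toNNReal * S (-s).toNNReal) * S (-t).toNNReal := by
          simp only [mul_assoc]
      _ = _ := by rw [← (hcomm _ _).eq]; simp only [mul_assoc]
  have hU0 : U 0 = 1 := by
    simp only [U, neg_zero, Real.toNNReal_zero, hTS]
  have hUle (t : ℝ) (x : X) : ‖U t x‖ ≤ ‖x‖ := (hT.norm_apply_le _ _).trans (hS.norm_apply_le _ _)
  have hUinv (t : ℝ) : U t * U (-t) = 1 := by rw [← hUadd, add_neg_cancel, hU0]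
  have hUnorm (t : ℝ) (x : X) : ‖U t x‖ = ‖x‖ := by
    refine le_antisymm (hUle t x) ?_
    have h1 : U (-t) (U t x) = x := by
      have := hUinv (-t)
      rw [neg_neg] at this
      exact congrArg (fun L : X →L[𝕜] X => L x) this
    exact (congrArg norm h1).symm.trans_le (hUle (-t) _)
  have hUU : IsUnitaryGroup U :=
    { map_zero := hU0
      map_add := hUadd
      continuous_orbit := fun x => continuous_iff_continuousAt.2 fun t =>
        tendsto_apply_of_norm_le (F := fun t : ℝ => T t.toNNReal)
          (fun t => hT.norm_apply_le _)
          (((hT.continuous_orbit _).comp continuous_real_toNNReal).tendsto t)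
          (((hS.continuous_orbit x).comp
            (continuous_real_toNNReal.comp continuous_neg)).tendsto t)
      mem_unitary := fun t => by
        have h1 : star (U t) * U t = 1 :=
          (ContinuousLinearMap.norm_map_iff_adjoint_comp_self (U t)).1 (hUnorm t)
        have h2 : star (U t) = U (-t) := left_inv_eq_right_inv h1 (hUinv t)
        exact Unitary.mem_iff.2 ⟨h1, by rw [h2, hUinv]⟩ }
  refine ⟨U, hUU, fun x y => ?_⟩
  rw [hUU.tendsto_nhdsNE_iff, hAT, ← tendsto_coe_nhdsGT_zero]
  refine tendsto_congr fun t => ?_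
  have hneg : (-(t : ℝ)).toNNReal = 0 := Real.toNNReal_of_nonpos (neg_nonpos.2 t.2)
  simp [U, hneg, hS.map_zero]

theorem generatesUnitaryGroup_iff {A : X →ₗ.[𝕜] X} (hdense : Dense (A.domain : Set X))
    (hclosed : A.IsClosed) :
    GeneratesUnitaryGroup A ↔ OpSkewSymmetric A ∧ OpSkewSymmetric A.adjoint := by
  have h : GeneratesUnitaryGroup A ↔
      GeneratesContractionSemigroup A ∧ GeneratesContractionSemigroup (-A) :=
    ⟨fun h => h.generatesContractionSemigroup,
      fun h => generatesUnitaryGroup_of_generatesContractionSemigroup hdense h.1 h.2⟩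
  rw [h, generatesContractionSemigroup_iff hdense hclosed,
    generatesContractionSemigroup_iff (by simpa using hdense) (isClosed_neg hclosed),
    adjoint_neg hdense, opSkewSymmetric_iff_opDissipative_neg,
    opSkewSymmetric_iff_opDissipative_neg]
  exact and_and_and_comm

end UnitaryGroups

end BoundaryTriplets

theorem mainTheorem6 {𝕜 : Type*} [RCLike 𝕜]
    {X : Type*} [NormedAddCommGroup X] [InnerProductSpace 𝕜 X] [CompleteSpace X]
    {𝓑 : Type*} [NormedAddCommGroup 𝓑] [InnerProductSpace 𝕜 𝓑] [CompleteSpace 𝓑]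
    {𝓚 : Type*} [NormedAddCommGroup 𝓚] [InnerProductSpace 𝕜 𝓚] [CompleteSpace 𝓚]
    (A₀ : X →ₗ.[𝕜] X) (hA₀_dense : Dense (A₀.domain : Set X))
    (hA₀_skew : OpSkewSymmetric A₀) (hA₀_closed : A₀.IsClosed)
    (Γ : BoundaryTriplet A₀ 𝓑) (W₁ W₂ : 𝓑 →L[𝕜] 𝓚) (WB : 𝓑 × 𝓑 →L[𝕜] 𝓚)
    (hWB : WB = W₁.coprod W₂)
    (A : X →ₗ.[𝕜] X) (hA : A = Γ.restrict (LinearMap.ker (WB : 𝓑 × 𝓑 →ₗ[𝕜] 𝓚))) :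
    -- (1) closedness
    A.IsClosed ∧
    -- (2) (maximal) dissipativity
    (OpDissipative A ↔ RelDissipative (LinearMap.ker (WB : 𝓑 × 𝓑 →ₗ[𝕜] 𝓚))) ∧
    (OpMaximalDissipative A ↔
      RelMaximalDissipative (LinearMap.ker (WB : 𝓑 × 𝓑 →ₗ[𝕜] 𝓚))) ∧
    -- (3) the adjoint; `A` is densely defined, so that its adjoint is an operator
    Dense (A.domain : Set X) ∧
    A.adjoint = -(Γ.restrict (LinearMap.range
      ((W₂.adjoint.prod W₁.adjoint : 𝓚 →L[𝕜] 𝓑 × 𝓑) : 𝓚 →ₗ[𝕜] 𝓑 × 𝓑)).topologicalClosure) ∧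
    -- (4) dissipativity and skew-symmetry of the adjoint
    (OpDissipative A.adjoint ↔
      (W₁.comp W₂.adjoint + W₂.comp W₁.adjoint).IsPositive) ∧
    (OpSkewSymmetric A.adjoint ↔
      W₁.comp W₂.adjoint + W₂.comp W₁.adjoint = 0) ∧
    -- (5) generation of a contraction semigroup
    (GeneratesContractionSemigroup A ↔
      OpDissipative A ∧ (W₁.comp W₂.adjoint + W₂.comp W₁.adjoint).IsPositive) ∧
    -- (6) generation of a unitary group
    (GeneratesUnitaryGroup A ↔
      OpSkewSymmetric A ∧ W₁.comp W₂.adjoint + W₂.comp W₁.adjoint = 0) := by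
  subst hWB hA
  have hclosed := Γ.isClosed_restrict hA₀_dense (C := LinearMap.ker
    ((W₁.coprod W₂ : 𝓑 × 𝓑 →L[𝕜] 𝓚) : 𝓑 × 𝓑 →ₗ[𝕜] 𝓚)) (W₁.coprod W₂).isClosed_ker
  have hdense := Γ.dense_domain_restrict hA₀_dense hA₀_skew (LinearMap.ker
    ((W₁.coprod W₂ : 𝓑 × 𝓑 →L[𝕜] 𝓚) : 𝓑 × 𝓑 →ₗ[𝕜] 𝓚))
  have hadj := Γ.adjoint_restrict hA₀_dense hA₀_skew _ _
    (mem_topologicalClosure_range_adjoint_iff W₁ W₂)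
  have hdiss := Γ.opDissipative_neg_restrict_iff.trans
    (isPositive_comp_adjoint_add_iff W₁ W₂).symm
  have hskew := Γ.opSkewSymmetric_neg_restrict_iff.trans
    (comp_adjoint_add_eq_zero_iff W₁ W₂).symm
  rw [← hadj] at hdiss hskew
  refine ⟨hclosed, Γ.opDissipative_restrict_iff,
    Γ.opMaximalDissipative_restrict_iff hA₀_dense hA₀_skew, hdense, hadj, hdiss, hskew, ?_, ?_⟩
  · rw [generatesContractionSemigroup_iff hdense hclosed, hdiss]
  · rw [generatesUnitaryGroup_iff hdense hclosed, hskew]
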